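/- **Theorem (Verification -- jump-control growth-environment model with state-dependent intensity).** Let $A,\phi,\sigma,\rho,\chi,\delta,\varepsilon,\beta>0$, $\varepsilon\neq1$, and $\alpha,\xi,\eta,\lambda_0,\lambda_1\ge0$. Put $\mathcal S=(0,\infty)^2$, $\bar\theta=\min\{1,\phi/\sigma\}$, $\omega(K,P)=e^{-\delta P^{\xi}K^{\eta}}$, $\lambda(P)=\lambda_0+\lambda_1P$ and $$U(C,P)=\frac{C^{1-\varepsilon}}{1-\varepsilon}-\chi\frac{P^{1+\beta}}{1+\beta}\qquad(C\ge0,\ P>0),$$ with $U(0,P)=-\infty$ if $\varepsilon>1$. Let $(\Omega,\mathcal F,\mathbb F,\mathbb P)$ be a filtered probability space satisfying the usual conditions and carrying an $\mathbb F$-Poisson random measure $N(ds,dr)$ on $[0,\infty)^2$ with intensity $ds\otimes dr$. For $(k,p)\in\mathcal S$ consider $$dK_t=\big((1-\theta_t)AK_t-C_t\big)dt-\big(1-\omega(K_{t-},P_t)\big)K_{t-}\,d\hat q_t,\qquad dP_t=\big((\phi-\sigma\theta_t)AK_t-\alpha P_t\big)dt,\qquad (K_0,P_0)=(k,p),$$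 where $\hat q_t=\int_{(0,t]}\int_{[0,\infty)}\mathbf 1_{\{r\le\lambda(P_s)\}}N(ds,dr)$ is the counting process of disasters, with intensity $\lambda(P_t)$. A control $(C,\theta)$ is admissible from $(k,p)$, written $(C,\theta)\in\mathcal A(k,p)$, if it is $\mathbb F$-progressively measurable, $C_t\ge0$ and $\theta_t\in[0,\bar\theta]$ for a.e. $t$, almost surely, the state equations have a pathwise unique strong solution $(K_t,P_t)$ with values in $\mathcal S$, and $\mathbb E\int_0^\infty e^{-\rho t}|U(C_t,P_t)|\,dt<\infty$. Its gain is $J(k,p;C,\theta)=\mathbb E\int_0^\infty e^{-\rho t}U(C_t,P_t)\,dt$. For $v\in C^2(\mathcal S)$, $C\ge0$ and $\theta\in[0,1]$ let $$(\mathcal L^{C,\theta}v)(K,P)=v_K(K,P)\big((1-\theta)AK-C\big)+v_P(K,P)\big((\phi-\sigma\theta)AK-\alpha P\big)+\lambda(P)\big(v(\omega(K,P)K,P)-v(K,P)\big).$$ Let $v\in C^2(\mathcal S)$ have at most polynomial growth, $|v(K,P)|\le c(1+K^{\gamma}+P^{d})$ on $\mathcal S$ for some $c>0$, $\gamma,d\ge0$,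 and satisfy the HJB equation $$\rho v(K,P)=\sup_{C\ge0,\ \theta\in[0,\bar\theta]}\big\{U(C,P)+(\mathcal L^{C,\theta}v)(K,P)\big\}\qquad\text{for all }(K,P)\in\mathcal S.$$ Let $(k,p)\in\mathcal S$ and assume the transversality condition $\lim_{T\to\infty}\mathbb E[e^{-\rho T}v(K_T,P_T)]=0$ for every $(C,\theta)\in\mathcal A(k,p)$ and the associated state process. Then: (i) (Upper bound) $v(k,p)\ge J(k,p;C,\theta)$ for every $(C,\theta)\in\mathcal A(k,p)$. (ii) (Optimality) Let $(\hat C,\hat\theta):\mathcal S\to[0,\infty)\times[0,1]$ be Borel functions such that, for all $(K,P)\in\mathcal S$, $$U(\hat C,P)+(\mathcal L^{\hat C,\hat\theta}v)(K,P)=\sup_{C\ge0,\ \theta\in[0,\bar\theta]}\big\{U(C,P)+(\mathcal L^{C,\theta}v)(K,P)\big\},$$ where $\hat C=\hat C(K,P)$, $\hat\theta=\hat\theta(K,P)$. If $(K_t,P_t)$ is an $\mathcal S$-valued solution of the closed-loop state equations from $(k,p)$, i.e. with $C_t=\hat C(K_t,P_t)$, $\theta_t=\hat\theta(K_t,P_t)$,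 and this feedback control is admissible from $(k,p)$, then it is optimal and $$v(k,p)=J(k,p;\hat C,\hat\theta)=\sup_{(C,\theta)\in\mathcal A(k,p)}J(k,p;C,\theta).$$ -/

import Mathlib

open MeasureTheory ProbabilityTheory Filter Topology
open scoped NNReal ENNReal

noncomputable section

/-- Lebesgue measure on the time axis `[0, ∞)`. -/
def lebNN : Measure ℝ≥0 := Measure.comap ((↑) : ℝ≥0 → ℝ) volume

/-- The open quadrant `(0, ∞) × (0, ∞)` of states (capital, pollution). -/
def stateSpace : Set (ℝ × ℝ) := Set.Ioi 0 ×ˢ Set.Ioi 0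

/-- The usual conditions: right continuity, and every `μ`-null set belongs to the initial
sigma-algebra. -/
structure UsualConditions {Ω : Type*} {mΩ : MeasurableSpace Ω} (𝓕 : Filtration ℝ≥0 mΩ)
    (μ : Measure Ω) : Prop where
  rightCont : 𝓕.IsRightContinuous
  complete : ∀ s : Set Ω, μ s = 0 → MeasurableSet[𝓕 0] s

/-- `N` is a Poisson random measure on `[0, ∞) × [0, ∞)` (points `(s, r)`: time and level) with
intensity `ds ⊗ dr`, relative to the filtration `𝓕`. -/
structure IsPoissonRandomMeasure {Ω : Type*} {mΩ : MeasurableSpace Ω} (𝓕 : Filtration ℝ≥0 mΩ)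
    (μ : Measure Ω) (N : Ω → Measure (ℝ≥0 × ℝ≥0)) : Prop where
  measurable : ∀ B : Set (ℝ≥0 × ℝ≥0), MeasurableSet B → Measurable fun ω => N ω B
  poisson : ∀ B : Set (ℝ≥0 × ℝ≥0), MeasurableSet B → (lebNN.prod lebNN) B ≠ ∞ →
    μ.map (fun ω => N ω B) =
      (poissonMeasure ((lebNN.prod lebNN) B).toNNReal).map (fun n : ℕ => (n : ℝ≥0∞))
  indep : ∀ (n : ℕ) (B : Fin n → Set (ℝ≥0 × ℝ≥0)), (∀ i, MeasurableSet (B i)) →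
    Pairwise (fun i j => Disjoint (B i) (B j)) → iIndepFun (fun i ω => N ω (B i)) μ
  adapted : ∀ (t : ℝ≥0) (B : Set (ℝ≥0 × ℝ≥0)), MeasurableSet B → B ⊆ Set.Iic t ×ˢ Set.univ →
    Measurable[𝓕 t] fun ω => N ω B
  indep_past : ∀ t : ℝ≥0,
    Indep (⨆ B : {B : Set (ℝ≥0 × ℝ≥0) // MeasurableSet B ∧ B ⊆ Set.Ioi t ×ˢ Set.univ},
      MeasurableSpace.comap (fun ω => N ω B.1) inferInstance) (𝓕 t) μ

/-- A path on `[0, ∞)` that is right-continuous with left limits. -/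
def IsCadlagPath (x : ℝ≥0 → ℝ) : Prop :=
  (∀ t, ContinuousWithinAt x (Set.Ici t) t) ∧ ∀ t, ∃ l, Tendsto x (𝓝[<] t) (𝓝 l)

/-- The parameters of the growth model. Output is `Y(K) = A K`. -/
structure GrowthModel where
  A : ℝ
  φ : ℝ
  σ : ℝ
  α : ℝ
  ρ : ℝ
  ε : ℝ
  β : ℝ
  χ : ℝ
  δ : ℝ
  ξ : ℝ
  η : ℝ
  lam0 : ℝ
  lam1 : ℝ
  A_pos : 0 < A
  φ_pos : 0 < φ
  σ_pos : 0 < σ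
  α_nonneg : 0 ≤ α
  ρ_pos : 0 < ρ
  ε_pos : 0 < ε
  ε_ne_one : ε ≠ 1
  β_pos : 0 < β
  χ_pos : 0 < χ
  δ_pos : 0 < δ
  ξ_nonneg : 0 ≤ ξ
  η_nonneg : 0 ≤ η
  lam0_nonneg : 0 ≤ lam0
  lam1_nonneg : 0 ≤ lam1

namespace GrowthModel

/-- Surviving share of capital after a disaster, `ω(K, P) = exp(-δ P^ξ K^η)`. -/
def survival (m : GrowthModel) (K P : ℝ) : ℝ := Real.exp (-m.δ * P ^ m.ξ * K ^ m.η)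

/-- Disaster intensity `λ(P) = λ₀ + λ₁ P`. -/
def intensity (m : GrowthModel) (P : ℝ) : ℝ := m.lam0 + m.lam1 * P

/-- Drift of capital. -/
def driftK (m : GrowthModel) (K C θ : ℝ) : ℝ := (1 - θ) * (m.A * K) - C

/-- Drift of pollution. -/
def driftP (m : GrowthModel) (K P θ : ℝ) : ℝ := (m.φ - m.σ * θ) * (m.A * K) - m.α * P

/-- Largest abatement share that keeps emissions nonnegative. -/
def thetaBar (m : GrowthModel) : ℝ := min 1 (m.φ / m.σ)

/-- Utility `C^(1-ε)/(1-ε) - χ P^(1+β)/(1+β)` for `C ≥ 0`, `P > 0`, extended-real valued because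
`C^(1-ε)/(1-ε) = -∞` at `C = 0` when `ε > 1`. -/
def utility (m : GrowthModel) (C P : ℝ) : EReal :=
  open Classical in
  if C = 0 ∧ 1 < m.ε then ⊥
  else ((C ^ (1 - m.ε) / (1 - m.ε) - m.χ * (P ^ (1 + m.β) / (1 + m.β)) : ℝ) : EReal)

/-- The controlled generator `(𝓛^{C,θ} v)(K, P)`. -/
def generator (m : GrowthModel) (v : ℝ × ℝ → ℝ) (C θ K P : ℝ) : ℝ :=
  deriv (fun x => v (x, P)) K * m.driftK K C θ
    + deriv (fun y => v (K, y)) P * m.driftP K P θ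
    + m.intensity P * (v (m.survival K P * K, P) - v (K, P))

/-- Admissible control values: `C ≥ 0` and `0 ≤ θ ≤ min(1, φ/σ)`. -/
def controlValues (m : GrowthModel) : Set (ℝ × ℝ) := Set.Ici 0 ×ˢ Set.Icc 0 m.thetaBar

/-- `sup_{(C,θ)} {U(C, P) + (𝓛^{C,θ} v)(K, P)}`. -/
def hjbSup (m : GrowthModel) (v : ℝ × ℝ → ℝ) (K P : ℝ) : EReal :=
  ⨆ a ∈ m.controlValues, m.utility a.1 P + (m.generator v a.1 a.2 K P : EReal)

/-- `v` solves the Hamilton-Jacobi-Bellman equation pointwise on the state space. -/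
def SolvesHJB (m : GrowthModel) (v : ℝ × ℝ → ℝ) : Prop :=
  ∀ K P : ℝ, 0 < K → 0 < P → ((m.ρ * v (K, P) : ℝ) : EReal) = m.hjbSup v K P

/-- The disaster arrivals as a random counting measure on the time axis, obtained by thinning:
`q(ds) = ∫ 1_{[0, λ(P_s)]}(r) N(ds, dr)`. The counting process is `q_t = q((0, t])`. -/
def arrivals (m : GrowthModel) {Ω : Type*} (N : Ω → Measure (ℝ≥0 × ℝ≥0)) (P : ℝ≥0 → Ω → ℝ)
    (ω : Ω) : Measure ℝ≥0 :=
  ((N ω).restrict {z | (z.2 : ℝ) ≤ m.intensity (P z.1 ω)}).map Prod.fst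

/-- Capital destroyed by a disaster at time `s`: `(1 - ω(K_{s-}, P_s)) K_{s-}`. -/
def loss (m : GrowthModel) {Ω : Type*} (K P : ℝ≥0 → Ω → ℝ) (ω : Ω) (s : ℝ≥0) : ℝ :=
  (1 - m.survival (Function.leftLim (fun u => K u ω) s) (P s ω))
    * Function.leftLim (fun u => K u ω) s

/-- `(K, P)` is a strong solution with values in the state space, started at `(k, p)`, of
`dK = b_K dt - (1 - ω(K_-, P)) K_- dq`, `dP = b_P dt` under the control `(C, θ)`. -/
structure IsStateSolution (m : GrowthModel) {Ω : Type*} {mΩ : MeasurableSpace Ω}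
    (𝓕 : Filtration ℝ≥0 mΩ) (μ : Measure Ω) (N : Ω → Measure (ℝ≥0 × ℝ≥0))
    (k p : ℝ) (C θ K P : ℝ≥0 → Ω → ℝ) : Prop where
  adaptedK : Adapted 𝓕 K
  adaptedP : Adapted 𝓕 P
  cadlagK : ∀ ω, IsCadlagPath fun t => K t ω
  continuousP : ∀ ω, Continuous fun t => P t ω
  mem : ∀ t ω, (K t ω, P t ω) ∈ stateSpace
  integrable_driftK : ∀ᵐ ω ∂μ, ∀ t : ℝ≥0,
    IntegrableOn (fun s => m.driftK (K s ω) (C s ω) (θ s ω)) (Set.Iic t) lebNN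
  integrable_driftP : ∀ᵐ ω ∂μ, ∀ t : ℝ≥0,
    IntegrableOn (fun s => m.driftP (K s ω) (P s ω) (θ s ω)) (Set.Iic t) lebNN
  integrable_loss : ∀ᵐ ω ∂μ, ∀ t : ℝ≥0,
    IntegrableOn (m.loss K P ω) (Set.Ioc 0 t) (m.arrivals N P ω)
  eqK : ∀ᵐ ω ∂μ, ∀ t : ℝ≥0,
    K t ω = k + (∫ s in Set.Iic t, m.driftK (K s ω) (C s ω) (θ s ω) ∂lebNN)
      - ∫ s in Set.Ioc 0 t, m.loss K P ω s ∂(m.arrivals N P ω)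
  eqP : ∀ᵐ ω ∂μ, ∀ t : ℝ≥0,
    P t ω = p + ∫ s in Set.Iic t, m.driftP (K s ω) (P s ω) (θ s ω) ∂lebNN

/-- The control `(C, θ)` belongs to the admissible class `𝒜(k, p)`. -/
structure IsAdmissible (m : GrowthModel) {Ω : Type*} {mΩ : MeasurableSpace Ω}
    (𝓕 : Filtration ℝ≥0 mΩ) (μ : Measure Ω) (N : Ω → Measure (ℝ≥0 × ℝ≥0))
    (k p : ℝ) (C θ : ℝ≥0 → Ω → ℝ) : Prop where
  progC : IsProgressive 𝓕 C
  progθ : IsProgressive 𝓕 θ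
  nonneg : ∀ᵐ ω ∂μ, ∀ᵐ t ∂lebNN, 0 ≤ C t ω
  mem_Icc : ∀ᵐ ω ∂μ, ∀ᵐ t ∂lebNN, θ t ω ∈ Set.Icc 0 m.thetaBar
  exists_state : ∃ K P : ℝ≥0 → Ω → ℝ, m.IsStateSolution 𝓕 μ N k p C θ K P
  unique_state : ∀ K P K' P' : ℝ≥0 → Ω → ℝ, m.IsStateSolution 𝓕 μ N k p C θ K P →
    m.IsStateSolution 𝓕 μ N k p C θ K' P' → ∀ᵐ ω ∂μ, ∀ t, K t ω = K' t ω ∧ P t ω = P' t ω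
  integrable_utility : ∀ K P : ℝ≥0 → Ω → ℝ, m.IsStateSolution 𝓕 μ N k p C θ K P →
    ∫⁻ ω, ∫⁻ t, ENNReal.ofReal (Real.exp (-m.ρ * t)) * (m.utility (C t ω) (P t ω)).abs ∂lebNN ∂μ
      < ∞

/-- The gain `J(k, p; C, θ) = E ∫₀^∞ e^{-ρ t} U(C_t, P_t) dt`, where `(K, P)` is the (pathwise
unique) state process of the control; the value `0` for controls without state process is
irrelevant. -/
def gain (m : GrowthModel) {Ω : Type*} {mΩ : MeasurableSpace Ω}
    (𝓕 : Filtration ℝ≥0 mΩ) (μ : Measure Ω) (N : Ω → Measure (ℝ≥0 × ℝ≥0))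
    (k p : ℝ) (C θ : ℝ≥0 → Ω → ℝ) : ℝ :=
  open Classical in
  if h : ∃ X : (ℝ≥0 → Ω → ℝ) × (ℝ≥0 → Ω → ℝ), m.IsStateSolution 𝓕 μ N k p C θ X.1 X.2 then
    ∫ ω, ∫ t, Real.exp (-m.ρ * t) * (m.utility (C t ω) (h.choose.2 t ω)).toReal ∂lebNN ∂μ
  else 0

/-- Transversality at `(k, p)`: `E[e^{-ρ T} v(K_T, P_T)] → 0` as `T → ∞`, for every admissible
control and the associated state process. -/
def Transversality (m : GrowthModel) {Ω : Type*} {mΩ : MeasurableSpace Ω}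
    (𝓕 : Filtration ℝ≥0 mΩ) (μ : Measure Ω) (N : Ω → Measure (ℝ≥0 × ℝ≥0))
    (v : ℝ × ℝ → ℝ) (k p : ℝ) : Prop :=
  ∀ C θ : ℝ≥0 → Ω → ℝ, m.IsAdmissible 𝓕 μ N k p C θ →
    ∀ K P : ℝ≥0 → Ω → ℝ, m.IsStateSolution 𝓕 μ N k p C θ K P →
      Tendsto (fun T : ℝ≥0 => ∫ ω, Real.exp (-m.ρ * T) * v (K T ω, P T ω) ∂μ) atTop (𝓝 0)

end GrowthModel

/-- At most polynomial growth on the state space. -/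
def PolynomialGrowth (v : ℝ × ℝ → ℝ) : Prop :=
  ∃ c γ d : ℝ, 0 < c ∧ 0 ≤ γ ∧ 0 ≤ d ∧
    ∀ K P : ℝ, 0 < K → 0 < P → |v (K, P)| ≤ c * (1 + K ^ γ + P ^ d)

end

noncomputable section

/-! Fix an admissible control with its state. Applied to `e^{-ρt} v(K_t, P_t)`, the
change-of-variables formula followed by compensation of the jumps gives `e^{-ρT} v(K_T, P_T) = v(k,
p) + ∫₀ᵀ e^{-ρs} (𝓛v - ρv) ds + M`, with `E[M] = 0`. By the HJB equation the integrand is at most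
`-e^{-ρs} U`, with equality along a maximising feedback. Taking expectations and letting `T → ∞`,
transversality removes the left side and leaves `0 ≤ v(k, p) - J`, respectively `0 = v(k, p) - J`.

The formula is pathwise, since there is no diffusion. On bounded time intervals disasters come from
a bounded window of the Poisson measure, which almost surely has integer mass and at most one point
at each time; so jumps are isolated and simple. Between jumps the path is absolutely continuous and
the ordinary chain rule holds almost everywhere (`chain_rule_real`). The pieces are glued by
connectedness of the time axis (`IsJumpPath.ito`).

That `M` is centred is the compensation formula: on predictable sets, `N` and its intensity induce
the same measure (`trim_compProd_windowKernel`), because `N` after time `a` is independent of `𝓕 a`.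
No localisation is needed: capital is at most `k e^{At}`, which also bounds pollution, so up to a
fixed horizon polynomial growth makes the jump integrand bounded (`exists_martingale_part`). The
conclusion is drawn in `dynkin`, `gain_le` and `gain_eq_value`. -/

/-! ### Lebesgue measure on the half-line and Poisson moments. -/

lemma measurableEmbedding_coe_nnreal : MeasurableEmbedding ((↑) : ℝ≥0 → ℝ) :=
  MeasurableEmbedding.subtype_coe measurableSet_Ici

lemma lebNN_apply (s : Set ℝ≥0) : lebNN s = volume (((↑) : ℝ≥0 → ℝ) '' s) :=
  measurableEmbedding_coe_nnreal.comap_apply _ _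

lemma coe_image_Ioc (a b : ℝ≥0) :
    ((↑) : ℝ≥0 → ℝ) '' Set.Ioc a b = Set.Ioc (a : ℝ) b := by
  ext x
  constructor
  · rintro ⟨y, hy, rfl⟩
    exact ⟨by exact_mod_cast hy.1, by exact_mod_cast hy.2⟩
  · rintro ⟨h1, h2⟩
    exact ⟨⟨x, a.2.trans h1.le⟩, ⟨h1, h2⟩, rfl⟩

lemma lebNN_Ioc (a b : ℝ≥0) : lebNN (Set.Ioc a b) = (b - a : ℝ≥0) := by
  rw [lebNN_apply, coe_image_Ioc, Real.volume_Ioc, NNReal.sub_def, ENNReal.ofReal]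

lemma coe_image_Iic (b : ℝ≥0) :
    ((↑) : ℝ≥0 → ℝ) '' Set.Iic b = Set.Icc (0 : ℝ) b := by
  ext x
  constructor
  · rintro ⟨y, hy, rfl⟩
    exact ⟨y.2, by exact_mod_cast hy⟩
  · rintro ⟨h1, h2⟩
    exact ⟨⟨x, h1⟩, h2, rfl⟩

lemma lebNN_Iic (b : ℝ≥0) : lebNN (Set.Iic b) = b := by
  rw [lebNN_apply, coe_image_Iic, Real.volume_Icc]
  simp

instance : SigmaFinite lebNN :=
  ⟨⟨{ set := fun n => Set.Iic (n : ℝ≥0)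
      set_mem := fun _ => trivial
      finite := fun n => by rw [lebNN_Iic]; exact ENNReal.coe_lt_top
      spanning := by
        refine Set.eq_univ_of_forall fun x => ?_
        obtain ⟨n, hn⟩ := exists_nat_ge x
        exact Set.mem_iUnion.2 ⟨n, hn⟩ }⟩⟩

instance : NullSingletonClass lebNN where
  measure_singleton x := by rw [lebNN_apply]; simp

/-- The mean of the Poisson distribution. -/
lemma lintegral_poissonMeasure_cast (r : ℝ≥0) :
    ∫⁻ n : ℕ, (n : ℝ≥0∞) ∂(poissonMeasure r) = r := by
  rw [lintegral_countable']
  have h : ∀ n : ℕ, (n : ℝ≥0∞) * poissonMeasure r {n}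
      = ENNReal.ofReal (n * (Real.exp (-r) * r ^ n / n.factorial)) := by
    intro n
    rw [poissonMeasure_singleton, ENNReal.ofReal_mul (by positivity), ENNReal.ofReal_natCast]
  simp_rw [h]
  have hs : HasSum (fun n : ℕ => (n : ℝ) * (Real.exp (-r) * r ^ n / n.factorial)) r := by
    -- With `p_n` the Poisson weights, `(n + 1) p_{n+1} = r p_n`; the term at `0` vanishes.
    rw [← hasSum_nat_add_iff' 1]
    have := (hasSum_one_poissonMeasure r).mul_left (r : ℝ)
    simp only [mul_one] at this
    have h2 : ∀ n : ℕ, ((n + 1 : ℕ) : ℝ) * (Real.exp (-r) * r ^ (n + 1) / (n + 1).factorial)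
        = r * (Real.exp (-r) * r ^ n / n.factorial) := by
      intro n
      rw [Nat.factorial_succ]
      have : (n.factorial : ℝ) ≠ 0 := by positivity
      push_cast
      field_simp
      ring
    simp_rw [h2]
    simpa using this
  rw [← ENNReal.ofReal_tsum_of_nonneg (fun n => by positivity) hs.summable, hs.tsum_eq]
  exact ENNReal.ofReal_coe_nnreal

/-- A Poisson variable is at least two with probability at most the square of its mean. -/
lemma poissonMeasure_two_le (r : ℝ≥0) : poissonMeasure r {n | 2 ≤ n} ≤ (r : ℝ≥0∞) ^ 2 := by
  have hc : {n : ℕ | 2 ≤ n} = (({0, 1} : Finset ℕ) : Set ℕ)ᶜ := by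
    ext n
    simp only [Finset.coe_insert, Finset.coe_singleton, Set.mem_compl_iff, Set.mem_insert_iff,
      Set.mem_singleton_iff, Set.mem_ofPred_eq]
    omega
  rw [hc, prob_compl_eq_one_sub (Finset.measurableSet _)]
  have h01 : poissonMeasure r (({0, 1} : Finset ℕ) : Set ℕ)
      = ENNReal.ofReal (Real.exp (-r) * (1 + r)) := by
    rw [← sum_measure_singleton, Finset.sum_pair (by norm_num), poissonMeasure_singleton,
      poissonMeasure_singleton, ← ENNReal.ofReal_add (by positivity) (by positivity)]
    congr 1
    simp
    ring
  rw [h01, ← ENNReal.ofReal_one, ← ENNReal.ofReal_sub _ (by positivity), ← ENNReal.ofReal_coe_nnreal,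
    ← ENNReal.ofReal_pow (by positivity)]
  apply ENNReal.ofReal_le_ofReal
  -- `e^{-r} (1 + r) ≥ (1 - r) (1 + r) = 1 - r²`.
  have := Real.add_one_le_exp (-(r : ℝ))
  have hr : (0 : ℝ) ≤ r := r.2
  nlinarith [mul_le_mul_of_nonneg_right this (by linarith : (0 : ℝ) ≤ 1 + r)]

/-! ### Integer values and simplicity of the Poisson random measure. -/

section PoissonRandomMeasure

variable {Ω : Type*} {mΩ : MeasurableSpace Ω} {𝓕 : Filtration ℝ≥0 mΩ} {μ : Measure Ω}
  {N : Ω → Measure (ℝ≥0 × ℝ≥0)}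

namespace IsPoissonRandomMeasure

lemma lintegral_apply (hN : IsPoissonRandomMeasure 𝓕 μ N) {B : Set (ℝ≥0 × ℝ≥0)}
    (hB : MeasurableSet B) (hfin : (lebNN.prod lebNN) B ≠ ∞) :
    ∫⁻ ω, N ω B ∂μ = (lebNN.prod lebNN) B := by
  have h1 : ∫⁻ x, x ∂(μ.map fun ω => N ω B) = ∫⁻ ω, N ω B ∂μ :=
    lintegral_map measurable_id (hN.measurable B hB)
  rw [← h1, hN.poisson B hB hfin,
    lintegral_map (f := fun x => x) measurable_id (measurable_of_countable _)]
  exact (lintegral_poissonMeasure_cast _).trans (ENNReal.coe_toNNReal hfin)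

lemma ae_mem_range (hN : IsPoissonRandomMeasure 𝓕 μ N) {B : Set (ℝ≥0 × ℝ≥0)}
    (hB : MeasurableSet B) (hfin : (lebNN.prod lebNN) B ≠ ∞) :
    ∀ᵐ ω ∂μ, ∃ n : ℕ, N ω B = n := by
  have hm : MeasurableSet (Set.range ((↑) : ℕ → ℝ≥0∞)) := (Set.countable_range _).measurableSet
  have h : ∀ᵐ x ∂(μ.map fun ω => N ω B), x ∈ Set.range ((↑) : ℕ → ℝ≥0∞) := by
    rw [hN.poisson B hB hfin]
    refine (ae_map_iff (measurable_of_countable _).aemeasurable hm).2 ?_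
    exact ae_of_all _ fun n => ⟨n, rfl⟩
  replace h := (ae_map_iff (hN.measurable B hB).aemeasurable hm).1 h
  filter_upwards [h] with ω ⟨n, hn⟩ using ⟨n, hn.symm⟩

lemma measure_two_le (hN : IsPoissonRandomMeasure 𝓕 μ N) {B : Set (ℝ≥0 × ℝ≥0)}
    (hB : MeasurableSet B) (hfin : (lebNN.prod lebNN) B ≠ ∞) :
    μ {ω | 2 ≤ N ω B} ≤ (lebNN.prod lebNN) B ^ 2 := by
  have h1 : μ {ω | 2 ≤ N ω B} = (μ.map fun ω => N ω B) (Set.Ici 2) :=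
    (Measure.map_apply (hN.measurable B hB) measurableSet_Ici).symm
  rw [h1, hN.poisson B hB hfin, Measure.map_apply (measurable_of_countable _) measurableSet_Ici]
  have h2 : (fun n : ℕ => (n : ℝ≥0∞)) ⁻¹' Set.Ici 2 = {n | 2 ≤ n} := by
    ext n
    simp only [Set.mem_preimage, Set.mem_Ici, Set.mem_ofPred_eq]
    exact_mod_cast Iff.rfl
  rw [h2]
  exact (poissonMeasure_two_le _).trans_eq (by rw [ENNReal.coe_toNNReal hfin])


end IsPoissonRandomMeasure
end PoissonRandomMeasure

/-- A finite measure with integer values on a generating π-system has only integer values. -/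
lemma exists_nat_eq_measure {α : Type*} {mα : MeasurableSpace α} (ν : Measure α)
    [IsFiniteMeasure ν] {S : Set (Set α)} (hS : mα = MeasurableSpace.generateFrom S)
    (hpi : IsPiSystem S) (huniv : ∃ n : ℕ, ν Set.univ = n) (h : ∀ s ∈ S, ∃ n : ℕ, ν s = n)
    (s : Set α) (hs : MeasurableSet s) : ∃ n : ℕ, ν s = n := by
  induction s, hs using MeasurableSpace.induction_on_inter hS hpi with
  | empty => exact ⟨0, by simp⟩
  | basic t ht => exact h t ht
  | compl t htm ih =>
    obtain ⟨n, hn⟩ := huniv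
    obtain ⟨k, hk⟩ := ih
    exact ⟨n - k, by rw [measure_compl htm (measure_ne_top _ _), hn, hk, ENNReal.natCast_sub]⟩
  | iUnion f hd hf ih =>
    choose k hk using ih
    have htop : ∑' i, (k i : ℝ≥0∞) ≠ ∞ := by
      simp_rw [← hk, ← measure_iUnion hd hf]
      exact measure_ne_top _ _
    -- A convergent series of natural numbers has only finitely many nonzero terms, so its sum is a
    -- natural number.
    have hfin : {i | k i ≠ 0}.Finite := by
      refine (ENNReal.finite_const_le_of_tsum_ne_top htop one_ne_zero).subset fun i hi => ?_
      have : 1 ≤ k i := Nat.one_le_iff_ne_zero.2 hi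
      show (1 : ℝ≥0∞) ≤ k i
      exact_mod_cast this
    refine ⟨∑ i ∈ hfin.toFinset, k i, ?_⟩
    rw [measure_iUnion hd hf]
    simp_rw [hk]
    rw [tsum_eq_sum (s := hfin.toFinset)]
    · push_cast; rfl
    · intro i hi
      simpa using hi

/-- The time-level window `(0, n] × [0, n]`. -/
def window (n : ℕ) : Set (ℝ≥0 × ℝ≥0) := Set.Ioc 0 (n : ℝ≥0) ×ˢ Set.Iic (n : ℝ≥0)

lemma measurableSet_window (n : ℕ) : MeasurableSet (window n) :=
  measurableSet_Ioc.prod measurableSet_Iic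

lemma prod_window (n : ℕ) : (lebNN.prod lebNN) (window n) = n * n := by
  rw [window, Measure.prod_prod, lebNN_Ioc, lebNN_Iic]
  simp

lemma prod_window_ne_top (n : ℕ) : (lebNN.prod lebNN) (window n) ≠ ∞ := by
  rw [prod_window]
  exact ENNReal.mul_ne_top (ENNReal.natCast_ne_top n) (ENNReal.natCast_ne_top n)

section PoissonRandomMeasure

variable {Ω : Type*} {mΩ : MeasurableSpace Ω} {𝓕 : Filtration ℝ≥0 mΩ} {μ : Measure Ω}
  {N : Ω → Measure (ℝ≥0 × ℝ≥0)}

namespace IsPoissonRandomMeasure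

/-- One null set has to serve all `B`, because the region below the intensity is itself random.
Integrality holds simultaneously on a countable algebra generating the Borel sets and extends by
`exists_nat_eq_measure`. -/
lemma ae_window_integer (hN : IsPoissonRandomMeasure 𝓕 μ N) (n : ℕ) :
    ∀ᵐ ω ∂μ, ∀ B, MeasurableSet B → ∃ k : ℕ, N ω (B ∩ window n) = k := by
  set S := generateSetAlgebra (MeasurableSpace.countableGeneratingSet (ℝ≥0 × ℝ≥0)) with hSdef
  have hSc : S.Countable :=
    countable_generateSetAlgebra MeasurableSpace.countable_countableGeneratingSet
  have hS : (Prod.instMeasurableSpace : MeasurableSpace (ℝ≥0 × ℝ≥0)) = MeasurableSpace.generateFrom S := by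
    rw [hSdef, generateFrom_generateSetAlgebra_eq,
      MeasurableSpace.generateFrom_countableGeneratingSet]
  have halg : IsSetAlgebra S := isSetAlgebra_generateSetAlgebra
  have hSm : ∀ s ∈ S, MeasurableSet s := by
    intro s hs
    rw [hS]
    exact MeasurableSpace.measurableSet_generateFrom hs
  have key : ∀ᵐ ω ∂μ, ∀ s ∈ S, ∃ k : ℕ, N ω (s ∩ window n) = k := by
    rw [ae_ball_iff hSc]
    intro s hs
    refine hN.ae_mem_range ((hSm s hs).inter (measurableSet_window n)) ?_
    exact ne_top_of_le_ne_top (prod_window_ne_top n) (measure_mono Set.inter_subset_right)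
  filter_upwards [key, hN.ae_mem_range (measurableSet_window n) (prod_window_ne_top n)]
    with ω h1 h2 B hB
  have : IsFiniteMeasure ((N ω).restrict (window n)) := ⟨by
    obtain ⟨k, hk⟩ := h2
    rw [Measure.restrict_apply_univ, hk]
    exact ENNReal.natCast_lt_top k⟩
  rw [← Measure.restrict_apply hB]
  refine exists_nat_eq_measure _ hS (fun s hs t ht _ => halg.inter_mem hs ht) ?_ ?_ B hB
  · rwa [Measure.restrict_apply_univ]
  · intro s hs
    rw [Measure.restrict_apply (hSm s hs)]
    exact h1 s hs

/-- No two points of the random measure in a window have the same time coordinate. -/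
lemma ae_window_simple (hN : IsPoissonRandomMeasure 𝓕 μ N) (n : ℕ) :
    ∀ᵐ ω ∂μ, ∀ s ∈ Set.Ioc (0 : ℝ≥0) n, N ω ({s} ×ˢ Set.Iic (n : ℝ≥0)) < 2 := by
  -- Time is cut into `n (k + 1)` cells of length `1 / (k + 1)`, each of intensity `n / (k + 1)`.
  -- Two points at a common time put two points in one cell, which has probability at most `n (k +
  -- 1) (n / (k + 1))² = n³ / (k + 1)`.
  set c : ℕ → ℕ → Set (ℝ≥0 × ℝ≥0) := fun k j =>
    Set.Ioc ((j : ℝ≥0) / (k + 1)) ((j + 1 : ℝ≥0) / (k + 1)) ×ˢ Set.Iic (n : ℝ≥0) with hc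
  have hcm : ∀ k j, MeasurableSet (c k j) := fun k j => measurableSet_Ioc.prod measurableSet_Iic
  have hcv : ∀ k j, (lebNN.prod lebNN) (c k j) = ((n / (k + 1) : ℝ≥0) : ℝ≥0∞) := by
    intro k j
    rw [hc, Measure.prod_prod, lebNN_Ioc, lebNN_Iic, ← ENNReal.coe_mul]
    congr 1
    rw [← NNReal.coe_inj]
    rw [NNReal.coe_mul, NNReal.coe_sub (by gcongr; exact le_self_add)]
    push_cast
    ring
  have hbad : ∀ k : ℕ, μ {ω | ∃ s ∈ Set.Ioc (0 : ℝ≥0) n, 2 ≤ N ω ({s} ×ˢ Set.Iic (n : ℝ≥0))}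
      ≤ ((n * (k + 1) * (n / (k + 1)) ^ 2 : ℝ≥0) : ℝ≥0∞) := by
    intro k
    calc _ ≤ μ (⋃ j ∈ Finset.range (n * (k + 1)), {ω | 2 ≤ N ω (c k j)}) := by
          refine measure_mono ?_
          rintro ω ⟨s, hs, h2⟩
          have hk : (0 : ℝ≥0) < k + 1 := by positivity
          have hpos : 0 < ⌈s * (k + 1)⌉₊ := Nat.ceil_pos.2 (mul_pos hs.1 hk)
          -- Cells are open on the left, so the cell containing `s` has index `⌈s (k + 1)⌉ - 1`.
          obtain ⟨j, hj⟩ := Nat.exists_eq_succ_of_ne_zero hpos.ne'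
          have hj1 : s * (k + 1) ≤ j + 1 := by
            have := Nat.le_ceil (s * (k + 1)); rw [hj] at this; exact_mod_cast this
          have hj2 : (j : ℝ≥0) < s * (k + 1) := by
            rw [← Nat.lt_ceil, hj]; exact Nat.lt_succ_self j
          have hj3 : j < n * (k + 1) := by
            have : (j : ℝ≥0) < n * (k + 1) := hj2.trans_le (by gcongr; exact hs.2)
            exact_mod_cast this
          refine Set.mem_biUnion (Finset.mem_coe.2 (Finset.mem_range.2 hj3)) ?_
          refine le_trans h2 (measure_mono (Set.prod_mono ?_ le_rfl))
          rw [Set.singleton_subset_iff]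
          exact ⟨by rwa [div_lt_iff₀ hk], by rwa [le_div_iff₀ hk]⟩
      _ ≤ ∑ j ∈ Finset.range (n * (k + 1)), μ {ω | 2 ≤ N ω (c k j)} := measure_biUnion_finset_le _ _
      _ ≤ ∑ j ∈ Finset.range (n * (k + 1)), (((n / (k + 1)) ^ 2 : ℝ≥0) : ℝ≥0∞) := by
          refine Finset.sum_le_sum fun j _ => ?_
          refine (hN.measure_two_le (hcm k j) (by rw [hcv]; exact ENNReal.coe_ne_top)).trans_eq ?_
          rw [hcv, ENNReal.coe_pow]
      _ = _ := by
          rw [Finset.sum_const, Finset.card_range, nsmul_eq_mul]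
          push_cast
          rfl
  have hlim : Tendsto (fun k : ℕ => (n * (k + 1) * (n / (k + 1)) ^ 2 : ℝ≥0)) atTop (𝓝 0) := by
    have h1 : Tendsto (fun k : ℕ => (n : ℝ≥0) ^ 3 / ((k + 1 : ℕ) : ℝ≥0)) atTop (𝓝 0) :=
      (tendsto_const_div_atTop_nhds_zero_nat (𝕜 := ℝ≥0) _).comp (tendsto_add_atTop_nat 1)
    refine h1.congr fun k => ?_
    have : (k + 1 : ℝ≥0) ≠ 0 := by positivity
    push_cast
    field_simp
  have h0 : μ {ω | ∃ s ∈ Set.Ioc (0 : ℝ≥0) n, 2 ≤ N ω ({s} ×ˢ Set.Iic (n : ℝ≥0))} = 0 := by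
    refine le_antisymm (ge_of_tendsto' (x := atTop) ?_ hbad) zero_le
    rw [← ENNReal.coe_zero, ENNReal.tendsto_coe]
    exact hlim
  rw [ae_iff]
  convert h0 using 3
  push Not
  rfl

end IsPoissonRandomMeasure
end PoissonRandomMeasure

/-- A kernel all of whose values are finite measures is s-finite. -/
lemma isSFiniteKernel_of_forall_ne_top {α β : Type*} {mα : MeasurableSpace α}
    {mβ : MeasurableSpace β} (κ : Kernel α β) (h : ∀ a, κ a Set.univ ≠ ∞) : IsSFiniteKernel κ := by
  classical
  -- The kernel is split according to the integer part of its total mass; each piece is a finite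
  -- kernel.
  have hm : Measurable fun a => ⌊(κ a Set.univ).toNNReal⌋₊ :=
    Nat.measurable_floor.comp (κ.measurable_coe MeasurableSet.univ).ennreal_toNNReal
  have hs : ∀ j : ℕ, MeasurableSet {a | ⌊(κ a Set.univ).toNNReal⌋₊ = j} := fun j =>
    hm (measurableSet_singleton j)
  refine ⟨⟨fun j => Kernel.piecewise (hs j) κ 0, fun j => ⟨⟨(j + 1 : ℝ≥0), ENNReal.coe_lt_top,
    fun a => ?_⟩⟩, ?_⟩⟩
  · rw [Kernel.piecewise_apply]
    split_ifs with ha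
    · have h1 := (Nat.lt_floor_add_one (κ a Set.univ).toNNReal).le
      rw [Set.mem_ofPred_eq] at ha
      rw [ha] at h1
      rw [← ENNReal.coe_toNNReal (h a)]
      exact_mod_cast h1
    · simp
  · ext a s hs'
    rw [Kernel.sum_apply' _ _ hs', tsum_eq_single ⌊(κ a Set.univ).toNNReal⌋₊]
    · simp [Kernel.piecewise_apply]
    · intro j hj
      simp [Kernel.piecewise_apply, hj.symm]

/-! ### Predictable integrands and the compensation formula. -/

section Compensation

variable {Ω : Type*} {mΩ : MeasurableSpace Ω}

/-- The σ-algebra of predictable events depending on a time and a level. -/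
@[reducible]
def predictableLevel (𝓕 : Filtration ℝ≥0 mΩ) : MeasurableSpace (Ω × (ℝ≥0 × ℝ≥0)) :=
  MeasurableSpace.generateFrom
    {G | ∃ (a : ℝ≥0) (F : Set Ω) (B : Set (ℝ≥0 × ℝ≥0)), MeasurableSet[𝓕 a] F ∧ MeasurableSet B ∧
      (B ⊆ Set.Ioi a ×ˢ Set.univ ∨ F = Set.univ) ∧ G = F ×ˢ B}

lemma predictableLevel_le (𝓕 : Filtration ℝ≥0 mΩ) :
    predictableLevel 𝓕 ≤ (Prod.instMeasurableSpace : MeasurableSpace (Ω × (ℝ≥0 × ℝ≥0))) := by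
  refine MeasurableSpace.generateFrom_le ?_
  rintro _ ⟨a, F, B, hF, hB, -, rfl⟩
  exact (𝓕.le a _ hF).prod hB

lemma measurableSet_predictableLevel {𝓕 : Filtration ℝ≥0 mΩ} {a : ℝ≥0} {F : Set Ω}
    {B : Set (ℝ≥0 × ℝ≥0)} (hF : MeasurableSet[𝓕 a] F) (hB : MeasurableSet B)
    (h : B ⊆ Set.Ioi a ×ˢ Set.univ ∨ F = Set.univ) : MeasurableSet[predictableLevel 𝓕] (F ×ˢ B) :=
  MeasurableSpace.measurableSet_generateFrom ⟨a, F, B, hF, hB, h, rfl⟩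

/-- The alternative `F = Set.univ` among the generators serves this purpose: deterministic sets are
predictable without restriction on time, time zero included. -/
lemma measurable_snd_predictableLevel (𝓕 : Filtration ℝ≥0 mΩ) :
    Measurable[predictableLevel 𝓕] (Prod.snd : Ω × (ℝ≥0 × ℝ≥0) → ℝ≥0 × ℝ≥0) := by
  intro B hB
  rw [← Set.univ_prod]
  exact measurableSet_predictableLevel (a := 0) MeasurableSet.univ hB (Or.inr rfl)

lemma isPiSystem_predictableLevel (𝓕 : Filtration ℝ≥0 mΩ) :
    IsPiSystem {G | ∃ (a : ℝ≥0) (F : Set Ω) (B : Set (ℝ≥0 × ℝ≥0)), MeasurableSet[𝓕 a] F ∧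
      MeasurableSet B ∧ (B ⊆ Set.Ioi a ×ˢ Set.univ ∨ F = Set.univ) ∧ G = F ×ˢ B} := by
  rintro _ ⟨a, F, B, hF, hB, h, rfl⟩ _ ⟨a', F', B', hF', hB', h', rfl⟩ -
  rw [Set.prod_inter_prod]
  rcases h with h | h
  · rcases h' with h' | h'
    · refine ⟨max a a', _, _, (𝓕.mono (le_max_left a a') _ hF).inter
        (𝓕.mono (le_max_right a a') _ hF'), hB.inter hB', Or.inl ?_, rfl⟩
      rintro z ⟨hz, hz'⟩
      exact ⟨Set.mem_Ioi.2 (max_lt (h hz).1 (h' hz').1), trivial⟩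
    · subst h'
      exact ⟨a, _, _, hF.inter MeasurableSet.univ, hB.inter hB',
        Or.inl (Set.inter_subset_left.trans h), rfl⟩
  · subst h
    refine ⟨a', _, _, MeasurableSet.univ.inter hF', hB.inter hB', ?_, rfl⟩
    rcases h' with h' | h'
    · exact Or.inl (Set.inter_subset_right.trans h')
    · exact Or.inr (by rw [h', Set.inter_univ])

/-- The left limits of a process (with value `0` at time `0`). -/
def leftLimProcess (X : ℝ≥0 → Ω → ℝ) (z : Ω × (ℝ≥0 × ℝ≥0)) : ℝ :=
  if z.2.1 = 0 then 0 else Function.leftLim (fun u => X u z.1) z.2.1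

lemma leftLimProcess_of_pos (X : ℝ≥0 → Ω → ℝ) (ω : Ω) {s : ℝ≥0} (hs : 0 < s) (r : ℝ≥0) :
    leftLimProcess X (ω, (s, r)) = Function.leftLim (fun u => X u ω) s := if_neg hs.ne'

lemma nnreal_nhdsLT_neBot {s : ℝ≥0} (hs : 0 < s) : (𝓝[<] s).NeBot :=
  nhdsLT_neBot_of_exists_lt ⟨0, hs⟩

/-- Left limits of adapted càdlàg processes are predictable. -/
lemma measurable_leftLimProcess {𝓕 : Filtration ℝ≥0 mΩ} {X : ℝ≥0 → Ω → ℝ} (hX : Adapted 𝓕 X)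
    (hc : ∀ ω, ∀ t, ∃ l, Tendsto (fun u => X u ω) (𝓝[<] t) (𝓝 l)) :
    Measurable[predictableLevel 𝓕] (leftLimProcess X) := by
  -- For `s > 0`, the last point of the grid of mesh `1 / (n + 1)` strictly before `s`. Strictness
  -- yields both the left limit and predictability.
  set g : ℕ → ℝ≥0 → ℝ≥0 := fun n s => ((⌈s * (n + 1)⌉₊ - 1 : ℕ) : ℝ≥0) / (n + 1) with hg
  have hlt : ∀ n s, 0 < s → g n s < s := by
    intro n s hs
    have hn : (0 : ℝ≥0) < n + 1 := by positivity
    rw [hg, div_lt_iff₀ hn, ← Nat.lt_ceil]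
    exact Nat.sub_lt (Nat.ceil_pos.2 (mul_pos hs hn)) one_pos
  have hge : ∀ n s, s ≤ g n s + 1 / (n + 1) := by
    intro n s
    have hn : (0 : ℝ≥0) < n + 1 := by positivity
    rw [hg, ← add_div, le_div_iff₀ hn]
    refine (Nat.le_ceil _).trans ?_
    exact_mod_cast (by omega : ⌈s * (n + 1)⌉₊ ≤ ⌈s * (n + 1)⌉₊ - 1 + 1)
  have hlim : ∀ s, 0 < s → Tendsto (fun n => g n s) atTop (𝓝[<] s) := by
    intro s hs
    rw [tendsto_nhdsWithin_iff]
    refine ⟨?_, Eventually.of_forall fun n => hlt n s hs⟩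
    have h1 : Tendsto (fun n : ℕ => s - 1 / ((n : ℝ≥0) + 1)) atTop (𝓝 (s - 0)) :=
      tendsto_const_nhds.sub tendsto_one_div_add_atTop_nhds_zero_nat
    rw [tsub_zero] at h1
    refine tendsto_of_tendsto_of_tendsto_of_le_of_le h1 tendsto_const_nhds (fun n => ?_)
      (fun n => (hlt n s hs).le)
    exact tsub_le_iff_right.2 (hge n s)
  let step : ℕ → Ω × (ℝ≥0 × ℝ≥0) → ℝ := fun n z => if z.2.1 = 0 then 0 else X (g n z.2.1) z.1
  have hstep : ∀ n, Measurable[predictableLevel 𝓕] (step n) := by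
    intro n A hA
    have hn : (0 : ℝ≥0) < n + 1 := by positivity
    -- On `(j / (n + 1), (j + 1) / (n + 1)]` the approximation reads `X` at the earlier time `j / (n
    -- + 1)`, so the preimage is a countable union of generating rectangles.
    have : step n ⁻¹' A = (Set.univ ×ˢ ({z : ℝ≥0 × ℝ≥0 | z.1 = 0 ∧ (0 : ℝ) ∈ A})) ∪
        ⋃ j : ℕ, ((X ((j : ℝ≥0) / (n + 1)) ⁻¹' A) ×ˢ
          (Set.Ioc ((j : ℝ≥0) / (n + 1)) ((j + 1 : ℝ≥0) / (n + 1)) ×ˢ Set.univ)) := by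
      ext ⟨ω, s, r⟩
      simp only [step, Set.mem_preimage, Set.mem_union, Set.mem_prod, Set.mem_univ, true_and,
        Set.mem_ofPred_eq, Set.mem_iUnion, Set.mem_Ioc, and_true]
      by_cases hs : s = 0
      · subst hs
        simp
      · have hs' : 0 < s := pos_iff_ne_zero.2 hs
        simp only [hs, if_false, false_and, false_or]
        constructor
        · intro h
          exact ⟨⌈s * (n + 1)⌉₊ - 1, h, hlt n s hs', by rw [add_div]; exact hge n s⟩
        · rintro ⟨j, h, h1, h2⟩
          have : ⌈s * (n + 1)⌉₊ = j + 1 := by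
            rw [Nat.ceil_eq_iff (by omega)]
            rw [div_lt_iff₀ hn] at h1
            rw [le_div_iff₀ hn] at h2
            exact ⟨by simpa using h1, by exact_mod_cast h2⟩
          rw [hg]
          simp only [this, Nat.add_sub_cancel]
          exact h
    rw [this]
    refine MeasurableSet.union ?_ (MeasurableSet.iUnion fun j => ?_)
    · refine measurableSet_predictableLevel (a := 0) MeasurableSet.univ ?_ (Or.inr rfl)
      exact (measurable_fst (measurableSet_singleton 0)).inter (MeasurableSet.const _)
    · exact measurableSet_predictableLevel (hX _ hA) (measurableSet_Ioc.prod MeasurableSet.univ)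
        (Or.inl (Set.prod_mono Set.Ioc_subset_Ioi_self le_rfl))
  refine @measurable_of_tendsto_metrizable _ _ (predictableLevel 𝓕) _ _ _ _ _ _ hstep
    (tendsto_pi_nhds.2 ?_)
  rintro ⟨ω, s, r⟩
  by_cases hs : s = 0
  · simp [step, leftLimProcess, hs]
  · have hs' : 0 < s := pos_iff_ne_zero.2 hs
    simp only [step, leftLimProcess, hs, if_false]
    exact (tendsto_leftLim_of_tendsto (hc ω s)).comp (hlim s hs')

variable {𝓕 : Filtration ℝ≥0 mΩ} {μ : Measure Ω} {N : Ω → Measure (ℝ≥0 × ℝ≥0)}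

namespace IsPoissonRandomMeasure

open Classical in
/-- The Poisson random measure in a window, as a kernel. -/
def windowKernel (hN : IsPoissonRandomMeasure 𝓕 μ N) (n : ℕ) : Kernel Ω (ℝ≥0 × ℝ≥0) :=
  Kernel.piecewise
    (measurableSet_lt (hN.measurable _ (measurableSet_window n)) measurable_const :
      MeasurableSet {ω | N ω (window n) < ∞})
    (Kernel.restrict ⟨N, Measure.measurable_of_measurable_coe _ hN.measurable⟩
      (measurableSet_window n)) 0

lemma windowKernel_apply (hN : IsPoissonRandomMeasure 𝓕 μ N) (n : ℕ) {ω : Ω}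
    (h : N ω (window n) < ∞) : hN.windowKernel n ω = (N ω).restrict (window n) := by
  simp only [windowKernel, Kernel.piecewise_apply, Set.mem_ofPred_eq, h, if_true,
    Kernel.restrict_apply]
  rfl

/-- Replacing infinite window mass by the zero measure makes `windowKernel` s-finite; this lemma
shows that the replacement is almost surely invisible. -/
lemma ae_window_lt_top (hN : IsPoissonRandomMeasure 𝓕 μ N) (n : ℕ) :
    ∀ᵐ ω ∂μ, N ω (window n) < ∞ := by
  filter_upwards [hN.ae_mem_range (measurableSet_window n) (prod_window_ne_top n)] with ω ⟨k, hk⟩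
  rw [hk]
  exact ENNReal.natCast_lt_top k

instance (hN : IsPoissonRandomMeasure 𝓕 μ N) (n : ℕ) : IsSFiniteKernel (hN.windowKernel n) := by
  refine isSFiniteKernel_of_forall_ne_top _ fun ω => ?_
  by_cases h : N ω (window n) < ∞
  · rw [hN.windowKernel_apply n h, Measure.restrict_apply_univ]
    exact h.ne
  · simp [windowKernel, Kernel.piecewise_apply, h]

lemma compProd_windowKernel_apply_prod [SFinite μ] (hN : IsPoissonRandomMeasure 𝓕 μ N) (n : ℕ)
    {F : Set Ω} (hF : MeasurableSet F) {B : Set (ℝ≥0 × ℝ≥0)} (hB : MeasurableSet B) :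
    (μ ⊗ₘ hN.windowKernel n) (F ×ˢ B) = ∫⁻ ω in F, N ω (B ∩ window n) ∂μ := by
  rw [Measure.compProd_apply_prod hF hB]
  refine lintegral_congr_ae (ae_restrict_of_ae ?_)
  filter_upwards [hN.ae_window_lt_top n] with ω hω
  rw [hN.windowKernel_apply n hω, Measure.restrict_apply hB]

/-- `B` lies strictly after time `a`, so `N B` is independent of `F` and the expectation factorises.
-/
lemma setLIntegral_past [IsProbabilityMeasure μ] (hN : IsPoissonRandomMeasure 𝓕 μ N) {a : ℝ≥0}
    {F : Set Ω} (hF : MeasurableSet[𝓕 a] F) {B : Set (ℝ≥0 × ℝ≥0)} (hB : MeasurableSet B)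
    (h : B ⊆ Set.Ioi a ×ˢ Set.univ) (hfin : (lebNN.prod lebNN) B ≠ ∞) :
    ∫⁻ ω in F, N ω B ∂μ = μ F * (lebNN.prod lebNN) B := by
  have hle : MeasurableSpace.comap (fun ω => N ω B) inferInstance ≤
      ⨆ B : {B : Set (ℝ≥0 × ℝ≥0) // MeasurableSet B ∧ B ⊆ Set.Ioi a ×ˢ Set.univ},
        MeasurableSpace.comap (fun ω => N ω B.1) inferInstance :=
    le_iSup (fun B : {B : Set (ℝ≥0 × ℝ≥0) // MeasurableSet B ∧ B ⊆ Set.Ioi a ×ˢ Set.univ} =>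
      MeasurableSpace.comap (fun ω => N ω B.1) inferInstance) ⟨B, hB, h⟩
  have hind := indep_of_indep_of_le_left (hN.indep_past a) hle
  have hsets : IndepSets {s | MeasurableSet[MeasurableSpace.comap (fun ω => N ω B) inferInstance] s}
      {F} μ :=
    indepSets_of_indepSets_of_le_right ((Indep_iff_IndepSets _ _ _).1 hind)
      (Set.singleton_subset_iff.2 hF)
  have key := lintegral_mul_indicator_eq_lintegral_mul_lintegral_indicator
    (hN.measurable B hB).comap_le 1 (𝓕.le a F hF) hsets (comap_measurable _)
  rw [lintegral_indicator_const (𝓕.le a F hF), one_mul, hN.lintegral_apply hB hfin] at key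
  rw [mul_comm, ← key, ← lintegral_indicator (𝓕.le a F hF)]
  refine lintegral_congr fun ω => ?_
  by_cases hω : ω ∈ F <;> simp [hω]

/-- Both measures are finite and agree on the π-system of generating rectangles: by independence of
the past for rectangles in the future, by the mean alone when `F = Set.univ`. Equality is claimed
only on predictable sets, hence the trimming. -/
lemma trim_compProd_windowKernel [IsProbabilityMeasure μ] (hN : IsPoissonRandomMeasure 𝓕 μ N)
    (n : ℕ) :
    (μ ⊗ₘ hN.windowKernel n).trim (predictableLevel_le 𝓕)
      = (μ.prod ((lebNN.prod lebNN).restrict (window n))).trim (predictableLevel_le 𝓕) := by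
  have hfin : ∀ B : Set (ℝ≥0 × ℝ≥0), (lebNN.prod lebNN) (B ∩ window n) ≠ ∞ := fun B =>
    ne_top_of_le_ne_top (prod_window_ne_top n) (measure_mono Set.inter_subset_right)
  have main : ∀ (a : ℝ≥0) (F : Set Ω) (B : Set (ℝ≥0 × ℝ≥0)), MeasurableSet[𝓕 a] F →
      MeasurableSet B → (B ⊆ Set.Ioi a ×ˢ Set.univ ∨ F = Set.univ) →
      (μ ⊗ₘ hN.windowKernel n) (F ×ˢ B)
        = (μ.prod ((lebNN.prod lebNN).restrict (window n))) (F ×ˢ B) := by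
    intro a F B hF hB h
    have hBw := hB.inter (measurableSet_window n)
    rw [hN.compProd_windowKernel_apply_prod n (𝓕.le a F hF) hB, Measure.prod_prod,
      Measure.restrict_apply hB]
    rcases h with h | rfl
    · exact hN.setLIntegral_past hF hBw (Set.inter_subset_left.trans h) (hfin B)
    · rw [Measure.restrict_univ, hN.lintegral_apply hBw (hfin B), measure_univ, one_mul]
  have huniv := main 0 Set.univ Set.univ MeasurableSet.univ MeasurableSet.univ (Or.inr rfl)
  rw [Set.univ_prod_univ] at huniv
  have hfinite : (μ ⊗ₘ hN.windowKernel n) Set.univ < ∞ := by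
    rw [huniv, ← Set.univ_prod_univ, Measure.prod_prod, Measure.restrict_apply_univ, measure_univ,
      one_mul]
    exact (prod_window_ne_top n).lt_top
  have : IsFiniteMeasure ((μ ⊗ₘ hN.windowKernel n).trim (predictableLevel_le 𝓕)) :=
    ⟨by rwa [trim_measurableSet_eq _ MeasurableSet.univ]⟩
  refine ext_of_generate_finite _ rfl (isPiSystem_predictableLevel 𝓕) ?_ ?_
  · rintro _ ⟨a, F, B, hF, hB, h, rfl⟩
    have hm := measurableSet_predictableLevel hF hB h
    rw [trim_measurableSet_eq _ hm, trim_measurableSet_eq _ hm, main a F B hF hB h]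
  · rw [trim_measurableSet_eq _ MeasurableSet.univ, trim_measurableSet_eq _ MeasurableSet.univ,
      huniv]

/-- The compensation formula for bounded predictable integrands. -/
lemma compensation [IsProbabilityMeasure μ] (hN : IsPoissonRandomMeasure 𝓕 μ N) (n : ℕ)
    {H : Ω × (ℝ≥0 × ℝ≥0) → ℝ} (hH : Measurable[predictableLevel 𝓕] H) {M : ℝ}
    (hM : ∀ z, |H z| ≤ M) :
    Integrable (fun ω => ∫ z in window n, H (ω, z) ∂(N ω)) μ ∧
    Integrable (fun ω => ∫ z in window n, H (ω, z) ∂(lebNN.prod lebNN)) μ ∧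
    ∫ ω, ∫ z in window n, H (ω, z) ∂(N ω) ∂μ
      = ∫ ω, ∫ z in window n, H (ω, z) ∂(lebNN.prod lebNN) ∂μ := by
  have htrim := hN.trim_compProd_windowKernel n
  have hfinw : IsFiniteMeasure ((lebNN.prod lebNN).restrict (window n)) :=
    ⟨by rw [Measure.restrict_apply_univ]; exact (prod_window_ne_top n).lt_top⟩
  have hfin : IsFiniteMeasure (μ ⊗ₘ hN.windowKernel n) := ⟨by
    rw [← trim_measurableSet_eq (predictableLevel_le 𝓕) MeasurableSet.univ, htrim,
      trim_measurableSet_eq _ MeasurableSet.univ]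
    exact measure_lt_top _ _⟩
  have hHm : Measurable H := hH.mono (predictableLevel_le 𝓕) le_rfl
  have hint : ∀ ν : Measure (Ω × (ℝ≥0 × ℝ≥0)), IsFiniteMeasure ν → Integrable H ν := fun ν _ =>
    Integrable.of_bound hHm.aestronglyMeasurable M (ae_of_all _ hM)
  have h1 := hint _ hfin
  have h2 := hint (μ.prod ((lebNN.prod lebNN).restrict (window n))) inferInstance
  have hcongr : (fun ω => ∫ z, H (ω, z) ∂(hN.windowKernel n ω))
      =ᵐ[μ] fun ω => ∫ z in window n, H (ω, z) ∂(N ω) := by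
    filter_upwards [hN.ae_window_lt_top n] with ω hω
    rw [hN.windowKernel_apply n hω]
  have h1' : Integrable (fun ω => ∫ z, H (ω, z) ∂(hN.windowKernel n ω)) μ :=
    Integrable.integral_compProd (κ := Kernel.const Unit μ) (a := ())
      (η := Kernel.prodMkLeft Unit (hN.windowKernel n)) h1
  refine ⟨h1'.congr hcongr, h2.integral_prod_left, ?_⟩
  -- Both sides are integrals over `Ω × [0, ∞)²`. As `H` is predictable, they depend only on the
  -- trimmed measures, which coincide.
  rw [← integral_congr_ae hcongr, ← Measure.integral_compProd h1, ← integral_prod _ h2,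
    integral_trim (predictableLevel_le 𝓕) hH.stronglyMeasurable, htrim,
    ← integral_trim (predictableLevel_le 𝓕) hH.stronglyMeasurable]

end IsPoissonRandomMeasure
end Compensation

/-! ### The chain rule along absolutely continuous paths. -/

lemma lebNN_restrict_Ioc (a b : ℝ≥0) :
    (lebNN.restrict (Set.Ioc a b)).map ((↑) : ℝ≥0 → ℝ) = volume.restrict (Set.Ioc (a : ℝ) b) := by
  ext s hs
  rw [measurableEmbedding_coe_nnreal.map_apply, Measure.restrict_apply' measurableSet_Ioc,
    Measure.restrict_apply hs, lebNN_apply, Set.image_preimage_inter, coe_image_Ioc]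

lemma integral_lebNN_Ioc {a b : ℝ≥0} (hab : a ≤ b) (f : ℝ≥0 → ℝ) :
    ∫ s in Set.Ioc a b, f s ∂lebNN = ∫ x in (a : ℝ)..b, f x.toNNReal := by
  rw [intervalIntegral.integral_of_le (by exact_mod_cast hab), ← lebNN_restrict_Ioc,
    measurableEmbedding_coe_nnreal.integral_map]
  simp

lemma integrableOn_lebNN_Ioc {a b : ℝ≥0} (hab : a ≤ b) (f : ℝ≥0 → ℝ) :
    IntegrableOn f (Set.Ioc a b) lebNN ↔
      IntervalIntegrable (fun x : ℝ => f x.toNNReal) volume a b := by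
  rw [intervalIntegrable_iff_integrableOn_Ioc_of_le (by exact_mod_cast hab), IntegrableOn,
    IntegrableOn, ← lebNN_restrict_Ioc, measurableEmbedding_coe_nnreal.integrable_map_iff]
  simp [Function.comp_def]

lemma restrict_lebNN_Iic (t : ℝ≥0) :
    lebNN.restrict (Set.Iic t) = lebNN.restrict (Set.Ioc 0 t) := by
  rw [← Set.Icc_bot, bot_eq_zero, restrict_Ioc_eq_restrict_Icc]

/-- Composing absolutely continuous functions with a Lipschitz function of two variables. -/
lemma LipschitzOnWith.comp_absolutelyContinuousOnInterval_prod {v : ℝ × ℝ → ℝ} {R : Set (ℝ × ℝ)}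
    {L : ℝ≥0} (hv : LipschitzOnWith L v R) {X Y : ℝ → ℝ} {a b : ℝ}
    (hX : AbsolutelyContinuousOnInterval X a b) (hY : AbsolutelyContinuousOnInterval Y a b)
    (hR : ∀ t ∈ Set.uIcc a b, (X t, Y t) ∈ R) :
    AbsolutelyContinuousOnInterval (fun t => v (X t, Y t)) a b := by
  unfold AbsolutelyContinuousOnInterval at hX hY ⊢
  refine squeeze_zero' (Eventually.of_forall fun _ => Finset.sum_nonneg fun _ _ => dist_nonneg) ?_
    (by simpa using (hX.add hY).const_mul (L : ℝ))
  rw [eventually_inf_principal]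
  refine Eventually.of_forall ?_
  rintro ⟨n, I⟩ hnI
  rw [← Finset.sum_add_distrib, Finset.mul_sum]
  refine Finset.sum_le_sum fun i hi => ?_
  have hmem := hnI.1 i hi
  refine (hv.dist_le_mul _ (hR _ hmem.1) _ (hR _ hmem.2)).trans ?_
  gcongr
  rw [Prod.dist_eq]
  exact max_le_add_of_nonneg dist_nonneg dist_nonneg

lemma isOpen_stateSpace : IsOpen stateSpace := isOpen_Ioi.prod isOpen_Ioi

/-- The time derivative of `e^{-ρ s} v` along a path with velocity `(f, g)`. -/
def discountedDrift (v : ℝ × ℝ → ℝ) (ρ s x y f g : ℝ) : ℝ :=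
  Real.exp (-ρ * s) * (-ρ * v (x, y) + deriv (fun x' => v (x', y)) x * f
    + deriv (fun y' => v (x, y')) y * g)

/-- The chain rule along an absolutely continuous curve. -/
lemma chain_rule_real {v : ℝ × ℝ → ℝ} (hv : ContDiffOn ℝ 2 v stateSpace) (ρ : ℝ) {a b : ℝ}
    (hab : a ≤ b) {X Y f g : ℝ → ℝ} (hf : IntervalIntegrable f volume a b)
    (hg : IntervalIntegrable g volume a b)
    (hX : ∀ t ∈ Set.Icc a b, X t = X a + ∫ s in a..t, f s)
    (hY : ∀ t ∈ Set.Icc a b, Y t = Y a + ∫ s in a..t, g s)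
    (hS : ∀ t ∈ Set.Icc a b, (X t, Y t) ∈ stateSpace) :
    IntervalIntegrable (fun s => discountedDrift v ρ s (X s) (Y s) (f s) (g s)) volume a b ∧
    ∫ s in a..b, discountedDrift v ρ s (X s) (Y s) (f s) (g s)
      = Real.exp (-ρ * b) * v (X b, Y b) - Real.exp (-ρ * a) * v (X a, Y a) := by
  have huIcc : Set.uIcc a b = Set.Icc a b := Set.uIcc_of_le hab
  -- The primitives agree with the paths on `[a, b]` and are defined on all of `ℝ`, so two-sided
  -- derivatives make sense whatever `X` and `Y` do outside.
  set x : ℝ → ℝ := fun t => X a + ∫ s in a..t, f s with hx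
  set y : ℝ → ℝ := fun t => Y a + ∫ s in a..t, g s with hy
  have hconst : ∀ c : ℝ, AbsolutelyContinuousOnInterval (fun _ => c) a b := fun c =>
    (contDiff_const (c := c) (n := 1)).contDiffOn.absolutelyContinuousOnInterval
  have hxac : AbsolutelyContinuousOnInterval x a b :=
    (hconst _).add (hf.absolutelyContinuousOnInterval_intervalIntegral Set.left_mem_uIcc)
  have hyac : AbsolutelyContinuousOnInterval y a b :=
    (hconst _).add (hg.absolutelyContinuousOnInterval_intervalIntegral Set.left_mem_uIcc)
  have hxS : ∀ t ∈ Set.Icc a b, (x t, y t) ∈ stateSpace := fun t ht => by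
    have := hS t ht
    rwa [hX t ht, hY t ht] at this
  have hxc : ContinuousOn x (Set.Icc a b) := huIcc ▸ hxac.continuousOn
  have hyc : ContinuousOn y (Set.Icc a b) := huIcc ▸ hyac.continuousOn
  -- The rectangle spanned by the two ranges is compact and convex, and stays in the quadrant
  -- because the quadrant is a product. Hence `v` is Lipschitz on it and its composition with the
  -- path is absolutely continuous.
  set R := (x '' Set.Icc a b) ×ˢ (y '' Set.Icc a b) with hR
  have hRc : IsCompact R :=
    (isCompact_Icc.image_of_continuousOn hxc).prod (isCompact_Icc.image_of_continuousOn hyc)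
  have hRv : Convex ℝ R := (isPreconnected_Icc.image x hxc).ordConnected.convex.prod
    (isPreconnected_Icc.image y hyc).ordConnected.convex
  have hRS : R ⊆ stateSpace := by
    rintro ⟨_, _⟩ ⟨⟨t, ht, rfl⟩, ⟨u, hu, rfl⟩⟩
    exact ⟨(hxS t ht).1, (hxS u hu).2⟩
  obtain ⟨L, hL⟩ := (hv.mono hRS).exists_lipschitzOnWith (by norm_num) hRv hRc
  have hvac := hL.comp_absolutelyContinuousOnInterval_prod hxac hyac
    (fun t ht => ⟨⟨t, huIcc ▸ ht, rfl⟩, ⟨t, huIcc ▸ ht, rfl⟩⟩)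
  have hexp : AbsolutelyContinuousOnInterval (fun t : ℝ => Real.exp (-ρ * t)) a b :=
    ContDiffOn.absolutelyContinuousOnInterval
      (Real.contDiff_exp.comp (contDiff_const.mul contDiff_id)).contDiffOn
  have hF := hexp.fun_mul hvac
  have hder : ∀ᵐ s, s ∈ Set.uIoc a b →
      deriv (fun t => Real.exp (-ρ * t) * v (x t, y t)) s
        = discountedDrift v ρ s (X s) (Y s) (f s) (g s) := by
    filter_upwards [hf.ae_hasDerivAt_integral, hg.ae_hasDerivAt_integral] with s h1 h2 hs
    have hs' : s ∈ Set.uIcc a b := Set.uIoc_subset_uIcc hs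
    have hsI : s ∈ Set.Icc a b := huIcc ▸ hs'
    have hxd : HasDerivAt x (f s) s := (h1 hs' a Set.left_mem_uIcc).const_add _
    have hyd : HasDerivAt y (g s) s := (h2 hs' a Set.left_mem_uIcc).const_add _
    have hvd : HasFDerivAt v (fderiv ℝ v (x s, y s)) (x s, y s) :=
      ((hv.contDiffAt (isOpen_stateSpace.mem_nhds (hxS s hsI))).differentiableAt
        (by norm_num)).hasFDerivAt
    have hcomp : HasDerivAt (fun t => v (x t, y t)) (fderiv ℝ v (x s, y s) (f s, g s)) s :=
      hvd.comp_hasDerivAt s (hxd.prodMk hyd)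
    have hvK : deriv (fun x' => v (x', y s)) (x s) = fderiv ℝ v (x s, y s) (1, 0) :=
      (hvd.comp_hasDerivAt (x s) ((hasDerivAt_id (x s)).prodMk (hasDerivAt_const _ (y s)))).deriv
    have hvP : deriv (fun y' => v (x s, y')) (y s) = fderiv ℝ v (x s, y s) (0, 1) :=
      (hvd.comp_hasDerivAt (y s) ((hasDerivAt_const _ (x s)).prodMk (hasDerivAt_id (y s)))).deriv
    have hexpd : HasDerivAt (fun t : ℝ => Real.exp (-ρ * t)) (Real.exp (-ρ * s) * (-ρ * 1)) s :=
      ((hasDerivAt_id s).const_mul (-ρ)).exp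
    rw [(hexpd.fun_mul hcomp).deriv, discountedDrift, hX s hsI, hY s hsI]
    change _ = Real.exp (-ρ * s) * (-ρ * v (x s, y s) + deriv (fun x' => v (x', y s)) (x s) * f s
      + deriv (fun y' => v (x s, y')) (y s) * g s)
    rw [hvK, hvP]
    have : ((f s, g s) : ℝ × ℝ) = f s • (1, 0) + g s • (0, 1) := by simp
    rw [this, map_add, map_smul, map_smul, smul_eq_mul, smul_eq_mul]
    ring
  refine ⟨hF.intervalIntegrable_deriv.congr_ae ((ae_restrict_iff' measurableSet_uIoc).2 hder), ?_⟩
  rw [← intervalIntegral.integral_congr_ae hder, hF.integral_deriv_eq_sub]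
  simp only [hX b (Set.right_mem_Icc.2 hab), hY b (Set.right_mem_Icc.2 hab), hx, hy,
    intervalIntegral.integral_same, add_zero]

lemma chain_rule {v : ℝ × ℝ → ℝ} (hv : ContDiffOn ℝ 2 v stateSpace) (ρ : ℝ) {a b : ℝ≥0}
    (hab : a ≤ b) {X Y f g : ℝ≥0 → ℝ} (hf : IntegrableOn f (Set.Ioc a b) lebNN)
    (hg : IntegrableOn g (Set.Ioc a b) lebNN)
    (hX : ∀ t ∈ Set.Icc a b, X t = X a + ∫ s in Set.Ioc a t, f s ∂lebNN)
    (hY : ∀ t ∈ Set.Icc a b, Y t = Y a + ∫ s in Set.Ioc a t, g s ∂lebNN)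
    (hS : ∀ t ∈ Set.Icc a b, (X t, Y t) ∈ stateSpace) :
    IntegrableOn (fun s : ℝ≥0 => discountedDrift v ρ s (X s) (Y s) (f s) (g s)) (Set.Ioc a b)
      lebNN ∧
    ∫ s in Set.Ioc a b, discountedDrift v ρ s (X s) (Y s) (f s) (g s) ∂lebNN
      = Real.exp (-ρ * b) * v (X b, Y b) - Real.exp (-ρ * a) * v (X a, Y a) := by
  have hab' : (a : ℝ) ≤ b := by exact_mod_cast hab
  have hmem : ∀ t ∈ Set.Icc (a : ℝ) b, t.toNNReal ∈ Set.Icc a b ∧ 0 ≤ t := fun t ht =>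
    ⟨⟨NNReal.le_toNNReal_of_coe_le ht.1, Real.toNNReal_le_iff_le_coe.2 ht.2⟩, a.2.trans ht.1⟩
  have key : ∀ (Z h : ℝ≥0 → ℝ),
      (∀ t ∈ Set.Icc a b, Z t = Z a + ∫ s in Set.Ioc a t, h s ∂lebNN) →
      ∀ t ∈ Set.Icc (a : ℝ) b,
        Z t.toNNReal = Z (a : ℝ).toNNReal + ∫ s in (a : ℝ)..t, h s.toNNReal := by
    intro Z h hZ t ht
    obtain ⟨h1, h2⟩ := hmem t ht
    rw [hZ _ h1, integral_lebNN_Ioc h1.1, Real.coe_toNNReal t h2, Real.toNNReal_coe]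
  have := chain_rule_real hv ρ hab' ((integrableOn_lebNN_Ioc hab f).1 hf)
    ((integrableOn_lebNN_Ioc hab g).1 hg) (key X f hX) (key Y g hY)
    (fun t ht => hS _ (hmem t ht).1)
  have hcongr : Set.EqOn (fun s : ℝ => discountedDrift v ρ s (X s.toNNReal) (Y s.toNNReal)
      (f s.toNNReal) (g s.toNNReal)) (fun s : ℝ => discountedDrift v ρ (s.toNNReal : ℝ)
      (X s.toNNReal) (Y s.toNNReal) (f s.toNNReal) (g s.toNNReal)) (Set.uIcc (a : ℝ) b) := by
    intro s hs
    rw [Set.uIcc_of_le hab'] at hs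
    simp only [Real.coe_toNNReal s (hmem s hs).2]
  rw [integrableOn_lebNN_Ioc hab, integral_lebNN_Ioc hab]
  refine ⟨this.1.congr (hcongr.mono Set.uIoc_subset_uIcc), ?_⟩
  rw [← intervalIntegral.integral_congr hcongr, this.2, Real.toNNReal_coe, Real.toNNReal_coe]

/-- Primitives are continuous. -/
lemma continuous_primitive_lebNN {f : ℝ≥0 → ℝ} (hf : ∀ t, IntegrableOn f (Set.Iic t) lebNN) :
    Continuous fun t : ℝ≥0 => ∫ s in Set.Iic t, f s ∂lebNN := by
  rw [continuous_iff_continuousAt]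
  intro t
  have hle : (0 : ℝ≥0) ≤ t + 1 := zero_le
  have h1 : IntervalIntegrable (fun x : ℝ => f x.toNNReal) volume (0 : ℝ) ((t + 1 : ℝ≥0) : ℝ) :=
    (integrableOn_lebNN_Ioc hle f).1 ((hf (t + 1)).mono_set Set.Ioc_subset_Iic_self)
  have h2 := intervalIntegral.continuousOn_primitive_interval (a := (0 : ℝ))
    (b := ((t + 1 : ℝ≥0) : ℝ)) (μ := volume) (f := fun x : ℝ => f x.toNNReal) (by
      rw [Set.uIcc_of_le (by positivity), integrableOn_Icc_iff_integrableOn_Ioc]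
      exact (intervalIntegrable_iff_integrableOn_Ioc_of_le (by positivity)).1 h1)
  have h3 : ContinuousOn (fun s : ℝ≥0 => ∫ x in (0 : ℝ)..(s : ℝ), f x.toNNReal)
      (Set.Iio (t + 1)) := by
    refine h2.comp NNReal.continuous_coe.continuousOn fun s hs => ?_
    rw [Set.uIcc_of_le (by positivity)]
    exact ⟨s.2, by exact_mod_cast (Set.mem_Iio.1 hs).le⟩
  refine (h3.continuousAt (Iio_mem_nhds (lt_add_one t))).congr (Eventually.of_forall fun s => ?_)
  simp only
  rw [restrict_lebNN_Iic, integral_lebNN_Ioc zero_le]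
  rfl

/-! ### Paths with isolated unit jumps. -/

/-- A path driven by an integrable drift and by unit jumps that do not accumulate. -/
structure IsJumpPath (q : Measure ℝ≥0) (x0 y0 : ℝ) (x y f g l : ℝ≥0 → ℝ) : Prop where
  leftLimit : ∀ t, ∃ z, Tendsto x (𝓝[<] t) (𝓝 z)
  integrable_f : ∀ t, IntegrableOn f (Set.Iic t) lebNN
  integrable_g : ∀ t, IntegrableOn g (Set.Iic t) lebNN
  integrable_l : ∀ t, IntegrableOn l (Set.Ioc 0 t) q
  eqx : ∀ t, x t = x0 + (∫ s in Set.Iic t, f s ∂lebNN) - ∫ s in Set.Ioc 0 t, l s ∂q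
  eqy : ∀ t, y t = y0 + ∫ s in Set.Iic t, g s ∂lebNN
  atom : ∀ t, 0 < t → q {t} = 0 ∨ q {t} = 1
  right : ∀ t, ∀ᶠ b in 𝓝[>] t, q (Set.Ioc t b) = 0
  left : ∀ t, ∀ᶠ a in 𝓝[<] t, q (Set.Ioo a t) = 0

lemma setIntegral_Iic_split {ν : Measure ℝ≥0} {f : ℝ≥0 → ℝ} {a b : ℝ≥0} (hab : a ≤ b)
    (hf : IntegrableOn f (Set.Iic b) ν) :
    ∫ s in Set.Iic b, f s ∂ν = (∫ s in Set.Iic a, f s ∂ν) + ∫ s in Set.Ioc a b, f s ∂ν := by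
  rw [← Set.Iic_union_Ioc_eq_Iic hab, setIntegral_union
    (Set.disjoint_left.2 fun z hz hz' => (not_lt.2 (Set.mem_Iic.1 hz)) hz'.1) measurableSet_Ioc
    (hf.mono_set (Set.Iic_subset_Iic.2 hab)) (hf.mono_set Set.Ioc_subset_Iic_self)]

lemma setIntegral_Ioc_split {ν : Measure ℝ≥0} {f : ℝ≥0 → ℝ} {a b : ℝ≥0} (hab : a ≤ b)
    (hf : IntegrableOn f (Set.Ioc 0 b) ν) :
    ∫ s in Set.Ioc 0 b, f s ∂ν = (∫ s in Set.Ioc 0 a, f s ∂ν) + ∫ s in Set.Ioc a b, f s ∂ν := by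
  rw [← Set.Ioc_union_Ioc_eq_Ioc (zero_le (a := a)) hab, setIntegral_union
    (Set.disjoint_left.2 fun z hz hz' => (not_lt.2 hz.2) hz'.1) measurableSet_Ioc
    (hf.mono_set (Set.Ioc_subset_Ioc_right hab)) (hf.mono_set (Set.Ioc_subset_Ioc_left zero_le))]

namespace IsJumpPath

variable {q : Measure ℝ≥0} {x0 y0 : ℝ} {x y f g l : ℝ≥0 → ℝ}

lemma x_eq_of_le (h : IsJumpPath q x0 y0 x y f g l) {a b : ℝ≥0} (hab : a ≤ b) :
    x b = x a + (∫ s in Set.Ioc a b, f s ∂lebNN) - ∫ s in Set.Ioc a b, l s ∂q := by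
  rw [h.eqx b, h.eqx a, setIntegral_Iic_split hab (h.integrable_f b),
    setIntegral_Ioc_split hab (h.integrable_l b)]
  ring

lemma y_eq_of_le (h : IsJumpPath q x0 y0 x y f g l) {a b : ℝ≥0} (hab : a ≤ b) :
    y b = y a + ∫ s in Set.Ioc a b, g s ∂lebNN := by
  rw [h.eqy b, h.eqy a, setIntegral_Iic_split hab (h.integrable_g b)]
  ring

lemma x_eq_of_no_jump (h : IsJumpPath q x0 y0 x y f g l) {a b : ℝ≥0} (hab : a ≤ b)
    (hq : q (Set.Ioc a b) = 0) : x b = x a + ∫ s in Set.Ioc a b, f s ∂lebNN := by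
  rw [h.x_eq_of_le hab, Measure.restrict_eq_zero.2 hq, integral_zero_measure, sub_zero]

lemma leftLim_eq (h : IsJumpPath q x0 y0 x y f g l) {a t : ℝ≥0} (hat : a < t)
    (hq : q (Set.Ioo a t) = 0) :
    Function.leftLim x t = x a + ∫ s in Set.Ioc a t, f s ∂lebNN := by
  have : (𝓝[<] t).NeBot := nnreal_nhdsLT_neBot (zero_le.trans_lt hat)
  refine leftLim_eq_of_tendsto ?_
  have h1 : Tendsto (fun u => x a + ((∫ s in Set.Iic u, f s ∂lebNN) - ∫ s in Set.Iic a, f s ∂lebNN))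
      (𝓝[<] t) (𝓝 (x a + ((∫ s in Set.Iic t, f s ∂lebNN) - ∫ s in Set.Iic a, f s ∂lebNN))) :=
    ((((continuous_primitive_lebNN h.integrable_f).tendsto t).mono_left nhdsWithin_le_nhds).sub_const
      _).const_add _
  have e : ∀ u, a ≤ u → (∫ s in Set.Iic u, f s ∂lebNN) - ∫ s in Set.Iic a, f s ∂lebNN
      = ∫ s in Set.Ioc a u, f s ∂lebNN := fun u hu => by
    rw [setIntegral_Iic_split hu (h.integrable_f u)]; ring
  rw [e t hat.le] at h1
  refine h1.congr' ?_
  filter_upwards [Ioo_mem_nhdsLT hat] with u hu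
  rw [e u hu.1.le, h.x_eq_of_no_jump hu.1.le
    (measure_mono_null (Set.Ioc_subset_Ioo_right hu.2) hq)]

lemma restrict_Ioc_eq {a t : ℝ≥0} (hat : a < t) (hq : q (Set.Ioo a t) = 0) :
    q.restrict (Set.Ioc a t) = q.restrict {t} := by
  refine Measure.restrict_congr_set ?_
  rw [← Set.Ioo_union_right hat]
  refine (ae_eq_set_union (ae_eq_empty.2 hq) (EventuallyEq.refl _ _)).trans ?_
  rw [Set.empty_union]
  rfl

lemma setIntegral_Ioc_eq_atom {a t : ℝ≥0} (hat : a < t) (hq : q (Set.Ioo a t) = 0)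
    (J : ℝ≥0 → ℝ) : ∫ s in Set.Ioc a t, J s ∂q = q.real {t} * J t := by
  rw [restrict_Ioc_eq hat hq, integral_singleton, smul_eq_mul]

lemma exists_left (h : IsJumpPath q x0 y0 x y f g l) {t : ℝ≥0} (ht : 0 < t) :
    ∃ a < t, q (Set.Ioo a t) = 0 := by
  have : (𝓝[<] t).NeBot := nnreal_nhdsLT_neBot ht
  obtain ⟨a, ha, hat⟩ := ((h.left t).and self_mem_nhdsWithin).exists
  exact ⟨a, hat, ha⟩

lemma jump_relation (h : IsJumpPath q x0 y0 x y f g l) {t : ℝ≥0} (ht : 0 < t) :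
    x t = Function.leftLim x t - q.real {t} * l t := by
  obtain ⟨a, hat, ha⟩ := h.exists_left ht
  rw [h.leftLim_eq hat ha, h.x_eq_of_le hat.le, setIntegral_Ioc_eq_atom hat ha]

/-- The increment of `e^{-ρ t} v` caused by a jump. -/
def jumpIncrement (v : ℝ × ℝ → ℝ) (ρ : ℝ) (x y l : ℝ≥0 → ℝ) (s : ℝ≥0) : ℝ :=
  Real.exp (-ρ * s) * (v (Function.leftLim x s - l s, y s) - v (Function.leftLim x s, y s))

lemma right_step (h : IsJumpPath q x0 y0 x y f g l) {v : ℝ × ℝ → ℝ}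
    (hv : ContDiffOn ℝ 2 v stateSpace) (ρ : ℝ) (hS : ∀ t, (x t, y t) ∈ stateSpace) {t b : ℝ≥0}
    (htb : t ≤ b) (hq : q (Set.Ioc t b) = 0) :
    IntegrableOn (fun s : ℝ≥0 => discountedDrift v ρ s (x s) (y s) (f s) (g s)) (Set.Ioc t b)
      lebNN ∧
    ∫ s in Set.Ioc t b, discountedDrift v ρ s (x s) (y s) (f s) (g s) ∂lebNN
      = Real.exp (-ρ * b) * v (x b, y b) - Real.exp (-ρ * t) * v (x t, y t) :=
  chain_rule hv ρ htb ((h.integrable_f b).mono_set Set.Ioc_subset_Iic_self)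
    ((h.integrable_g b).mono_set Set.Ioc_subset_Iic_self)
    (fun _ hu => h.x_eq_of_no_jump hu.1 (measure_mono_null (Set.Ioc_subset_Ioc_right hu.2) hq))
    (fun _ hu => h.y_eq_of_le hu.1) (fun u _ => hS u)

/-- A jump can occur only at the right endpoint. With the value there replaced by the left limit,
the path is absolutely continuous on `[a, t]`; the atom of `q` at `t` accounts for the remaining
difference. -/
lemma left_step (h : IsJumpPath q x0 y0 x y f g l) {v : ℝ × ℝ → ℝ}
    (hv : ContDiffOn ℝ 2 v stateSpace) (ρ : ℝ) (hS : ∀ t, (x t, y t) ∈ stateSpace)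
    (hpos : ∀ t, 0 < Function.leftLim x t) {a t : ℝ≥0} (hat : a < t) (hq : q (Set.Ioo a t) = 0) :
    IntegrableOn (fun s : ℝ≥0 => discountedDrift v ρ s (x s) (y s) (f s) (g s)) (Set.Ioc a t)
      lebNN ∧
    (∫ s in Set.Ioc a t, discountedDrift v ρ s (x s) (y s) (f s) (g s) ∂lebNN)
      + ∫ s in Set.Ioc a t, jumpIncrement v ρ x y l s ∂q
      = Real.exp (-ρ * t) * v (x t, y t) - Real.exp (-ρ * a) * v (x a, y a) := by
  classical
  set X : ℝ≥0 → ℝ := Function.update x t (Function.leftLim x t) with hX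
  have hXt : X t = Function.leftLim x t := Function.update_self ..
  have hXne : ∀ u, u ≠ t → X u = x u := fun u hu => Function.update_of_ne hu ..
  have hXa : X a = x a := hXne a hat.ne
  have key := chain_rule (X := X) (Y := y) hv ρ hat.le
    ((h.integrable_f t).mono_set Set.Ioc_subset_Iic_self)
    ((h.integrable_g t).mono_set Set.Ioc_subset_Iic_self)
    (fun u hu => by
      rw [hXa]
      rcases hu.2.eq_or_lt with rfl | hut
      · rw [hXt, h.leftLim_eq hat hq]
      · rw [hXne u hut.ne]
        exact h.x_eq_of_no_jump hu.1
          (measure_mono_null (Set.Ioc_subset_Ioo_right hut) hq))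
    (fun u hu => h.y_eq_of_le hu.1)
    (fun u hu => by
      rcases hu.2.eq_or_lt with rfl | hut
      · rw [hXt]; exact ⟨hpos u, (hS u).2⟩
      · rw [hXne u hut.ne]; exact hS u)
  have hae : (fun s : ℝ≥0 => discountedDrift v ρ s (X s) (y s) (f s) (g s))
      =ᵐ[lebNN.restrict (Set.Ioc a t)]
        fun s : ℝ≥0 => discountedDrift v ρ s (x s) (y s) (f s) (g s) := by
    refine ae_restrict_of_ae ?_
    filter_upwards [compl_mem_ae_iff.2 (measure_singleton t)] with s hs
    rw [hXne s hs]
  refine ⟨key.1.congr hae, ?_⟩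
  rw [← integral_congr_ae hae, key.2, hXt, hXa, setIntegral_Ioc_eq_atom hat hq,
    h.jump_relation (zero_le.trans_lt hat), jumpIncrement]
  -- Simplicity matters: an atom of mass `c` moves `x` by `c l`, and the change in `v` is `c` times
  -- the increment for `l` in general only if `c` is `0` or `1`.
  rcases h.atom t (zero_le.trans_lt hat) with h0 | h1
  · simp only [Measure.real, h0, ENNReal.toReal_zero, zero_mul, sub_zero]
    ring
  · simp only [Measure.real, h1, ENNReal.toReal_one, one_mul]
    ring

/-- Each time has one-sided neighbourhoods without interior jumps, where the chain rule gives
integrability; compactness of `[0, t]` then replaces an enumeration of the jump times. -/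
lemma integrableOn_discountedDrift (h : IsJumpPath q x0 y0 x y f g l) {v : ℝ × ℝ → ℝ}
    (hv : ContDiffOn ℝ 2 v stateSpace) (ρ : ℝ) (hS : ∀ t, (x t, y t) ∈ stateSpace)
    (hpos : ∀ t, 0 < Function.leftLim x t) (t : ℝ≥0) :
    IntegrableOn (fun s : ℝ≥0 => discountedDrift v ρ s (x s) (y s) (f s) (g s)) (Set.Iic t)
      lebNN := by
  have hloc : LocallyIntegrable
      (fun s : ℝ≥0 => discountedDrift v ρ s (x s) (y s) (f s) (g s)) lebNN := by
    intro t
    rw [← nhdsLT_sup_nhdsGE, ← Set.Ioi_insert, nhdsWithin_insert]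
    refine IntegrableAtFilter.sup_iff.2 ⟨?_, IntegrableAtFilter.sup_iff.2 ⟨?_, ?_⟩⟩
    · rcases eq_zero_or_pos t with rfl | ht
      · refine ⟨∅, ?_, integrableOn_empty⟩
        have : Set.Iio (0 : ℝ≥0) = ∅ := by ext; simp
        rw [this, nhdsWithin_empty]
        trivial
      · obtain ⟨a, hat, ha⟩ := h.exists_left ht
        exact ⟨Set.Ioc a t, mem_of_superset (Ioo_mem_nhdsLT hat) Set.Ioo_subset_Ioc_self,
          (h.left_step hv ρ hS hpos hat ha).1⟩
    · exact ⟨{t}, mem_pure.2 rfl, integrableOn_singleton enorm_ne_top (by simp)⟩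
    · obtain ⟨b, hb, htb⟩ := ((h.right t).and self_mem_nhdsWithin).exists
      exact ⟨Set.Ioc t b, Ioc_mem_nhdsGT htb, (h.right_step hv ρ hS (le_of_lt htb) hb).1⟩
  rw [← Set.Icc_bot]
  exact hloc.integrableOn_isCompact isCompact_Icc

/-- No condition on `J` is needed, since on bounded intervals away from `0` the measure `q` is a
finite sum of unit atoms. The restriction to positive times in the proof avoids a possible atom at
`0`. -/
lemma integrableOn_of_isJumpPath (h : IsJumpPath q x0 y0 x y f g l) (J : ℝ≥0 → ℝ) (t : ℝ≥0) :
    IntegrableOn J (Set.Ioc 0 t) q := by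
  have hloc : LocallyIntegrable J (q.restrict (Set.Ioi 0)) := by
    intro t
    rw [← nhdsLT_sup_nhdsGE, ← Set.Ioi_insert, nhdsWithin_insert]
    have hz : ∀ s, q s = 0 → IntegrableOn J s (q.restrict (Set.Ioi 0)) := fun s hs => by
      rw [IntegrableOn, Measure.restrict_eq_zero.2
        (Measure.absolutelyContinuous_of_le Measure.restrict_le_self hs)]
      exact integrable_zero_measure
    refine IntegrableAtFilter.sup_iff.2 ⟨?_, IntegrableAtFilter.sup_iff.2 ⟨?_, ?_⟩⟩
    · rcases eq_zero_or_pos t with rfl | ht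
      · refine ⟨∅, ?_, integrableOn_empty⟩
        have : Set.Iio (0 : ℝ≥0) = ∅ := by ext; simp
        rw [this, nhdsWithin_empty]
        trivial
      · obtain ⟨a, hat, ha⟩ := h.exists_left ht
        exact ⟨Set.Ioo a t, Ioo_mem_nhdsLT hat, hz _ ha⟩
    · refine ⟨{t}, mem_pure.2 rfl, integrableOn_singleton enorm_ne_top ?_⟩
      rcases eq_zero_or_pos t with rfl | ht
      · rw [Measure.restrict_apply (measurableSet_singleton _)]
        have : ({0} : Set ℝ≥0) ∩ Set.Ioi 0 = ∅ := by ext; simp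
        simp [this]
      · refine (Measure.restrict_le_self _).trans_lt ?_
        rcases h.atom t ht with h0 | h0 <;> simp [h0]
    · obtain ⟨b, hb, htb⟩ := ((h.right t).and self_mem_nhdsWithin).exists
      exact ⟨Set.Ioc t b, Ioc_mem_nhdsGT htb, hz _ hb⟩
  have h1 := hloc.integrableOn_isCompact (isCompact_Icc (a := (0 : ℝ≥0)) (b := t))
  rw [IntegrableOn, Measure.restrict_restrict measurableSet_Icc] at h1
  exact (show IntegrableOn J (Set.Icc 0 t ∩ Set.Ioi 0) q from h1).mono_set
    fun s hs => ⟨⟨zero_le, hs.2⟩, hs.1⟩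

/-- The change-of-variables formula along a jump path. -/
lemma ito (h : IsJumpPath q x0 y0 x y f g l) {v : ℝ × ℝ → ℝ}
    (hv : ContDiffOn ℝ 2 v stateSpace) (ρ : ℝ) (hS : ∀ t, (x t, y t) ∈ stateSpace)
    (hpos : ∀ t, 0 < Function.leftLim x t) (t : ℝ≥0) :
    Real.exp (-ρ * t) * v (x t, y t) = v (x0, y0)
      + (∫ s in Set.Iic t, discountedDrift v ρ s (x s) (y s) (f s) (g s) ∂lebNN)
      + ∫ s in Set.Ioc 0 t, jumpIncrement v ρ x y l s ∂q := by
  set D : ℝ≥0 → ℝ := fun s => discountedDrift v ρ s (x s) (y s) (f s) (g s)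
  set J : ℝ≥0 → ℝ := jumpIncrement v ρ x y l
  set G : ℝ≥0 → ℝ := fun t => Real.exp (-ρ * t) * v (x t, y t) - (∫ s in Set.Iic t, D s ∂lebNN)
    - ∫ s in Set.Ioc 0 t, J s ∂q with hG
  have hDi := h.integrableOn_discountedDrift hv ρ hS hpos
  have hJi := h.integrableOn_of_isJumpPath J
  -- The one-sided steps make `G` constant near every time; connectedness of `[0, ∞)` makes it
  -- constant.
  have hloc : IsLocallyConstant G := by
    rw [IsLocallyConstant.iff_eventually_eq]
    intro t
    rw [← nhdsLT_sup_nhdsGE, ← Set.Ioi_insert, nhdsWithin_insert, eventually_sup, eventually_sup]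
    refine ⟨?_, rfl, ?_⟩
    · filter_upwards [h.left t, self_mem_nhdsWithin] with a ha hat
      have hat : a < t := hat
      have := (h.left_step hv ρ hS hpos hat ha).2
      simp only [hG]
      rw [setIntegral_Iic_split hat.le (hDi t), setIntegral_Ioc_split hat.le (hJi t)]
      linarith
    · filter_upwards [h.right t, self_mem_nhdsWithin] with b hb htb
      have htb : t < b := htb
      have := (h.right_step hv ρ hS htb.le hb).2
      simp only [hG]
      rw [setIntegral_Iic_split htb.le (hDi b), setIntegral_Ioc_split htb.le (hJi b),
        Measure.restrict_eq_zero.2 hb, integral_zero_measure]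
      linarith
  have hpre : IsPreconnected (Set.univ : Set ℝ≥0) := isPreconnected_univ
  have hGt : G t = G 0 := hloc.apply_eq_of_isPreconnected hpre trivial trivial
  have h0 : ∀ φ : ℝ≥0 → ℝ, ∫ s in Set.Iic 0, φ s ∂lebNN = 0 := fun φ => by
    rw [restrict_lebNN_Iic, Set.Ioc_self, setIntegral_empty]
  have hx0 : x 0 = x0 := by rw [h.eqx 0, h0]; simp
  have hy0 : y 0 = y0 := by rw [h.eqy 0, h0]; simp
  have hG0 : G 0 = v (x0, y0) := by
    simp only [hG]
    rw [h0, hx0, hy0]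
    simp
  rw [hG0] at hGt
  rw [← hGt]
  simp only [hG]
  ring

end IsJumpPath

lemma IsJumpPath.ae_leftLim_eq {q : Measure ℝ≥0} {x0 y0 : ℝ} {x y f g l : ℝ≥0 → ℝ}
    (h : IsJumpPath q x0 y0 x y f g l) : ∀ᵐ s ∂lebNN, Function.leftLim x s = x s := by
  have hsub : {s | ¬ Function.leftLim x s = x s} ⊆ {s | 0 < s ∧ q {s} ≠ 0} := by
    intro s hs
    rcases eq_zero_or_pos s with rfl | hs0
    · exact absurd (leftLim_eq_of_isBot (fun b => zero_le)) hs
    · refine ⟨hs0, fun h0 => hs ?_⟩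
      rw [h.jump_relation hs0, Measure.real, h0]
      simp
  rw [ae_iff]
  -- The atoms are isolated, so near each of them the exceptional set reduces to a single null
  -- point.
  refine measure_mono_null hsub (measure_null_of_locally_null _ fun t ht => ⟨{t}, ?_, by simp⟩)
  obtain ⟨a, hat, ha⟩ := h.exists_left ht.1
  obtain ⟨b, hb, htb⟩ := ((h.right t).and self_mem_nhdsWithin).exists
  refine mem_nhdsWithin.2 ⟨Set.Ioo a b, isOpen_Ioo, ⟨hat, htb⟩, ?_⟩
  rintro s ⟨hs, hs'⟩
  by_contra hne
  rcases lt_or_gt_of_ne hne with hlt | hgt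
  · exact hs'.2 (measure_mono_null (Set.singleton_subset_iff.2 (Set.mem_Ioo.2 ⟨hs.1, hlt⟩)) ha)
  · exact hs'.2 (measure_mono_null (Set.singleton_subset_iff.2 (Set.mem_Ioc.2 ⟨hgt, hs.2.le⟩)) hb)

/-- A measure on the time axis with integer values on bounded sets charges no small punctured
neighbourhood. -/
lemma eventually_measure_Ioc_eq_zero {q : Measure ℝ≥0}
    (hq : ∀ T : ℝ≥0, ∀ A, MeasurableSet A → A ⊆ Set.Ioc 0 T → ∃ k : ℕ, q A = k) (t : ℝ≥0) :
    (∀ᶠ b in 𝓝[>] t, q (Set.Ioc t b) = 0) ∧ ∀ᶠ a in 𝓝[<] t, q (Set.Ioo a t) = 0 := by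
  -- An integer mass below `1` is zero. By continuity from above, the mass of shrinking punctured
  -- intervals does fall below `1`.
  have hzero : ∀ T : ℝ≥0, ∀ A, MeasurableSet A → A ⊆ Set.Ioc 0 T → q A < 1 → q A = 0 := by
    intro T A hA hAT h1
    obtain ⟨k, hk⟩ := hq T A hA hAT
    rw [hk] at h1 ⊢
    have : k < 1 := by exact_mod_cast h1
    interval_cases k
    simp
  have hfin : ∀ T : ℝ≥0, ∀ A, MeasurableSet A → A ⊆ Set.Ioc 0 T → q A ≠ ∞ := by
    intro T A hA hAT
    obtain ⟨k, hk⟩ := hq T A hA hAT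
    rw [hk]
    exact ENNReal.natCast_ne_top k
  constructor
  · have h1 : Tendsto (q ∘ fun b => Set.Ioc t b) (𝓝[>] t) (𝓝 (q (⋂ r > t, Set.Ioc t r))) := by
      refine tendsto_measure_biInter_gt (fun r _ => measurableSet_Ioc.nullMeasurableSet)
        (fun i j _ hij => Set.Ioc_subset_Ioc_right hij) ⟨t + 1, by simp, ?_⟩
      exact hfin (t + 1) _ measurableSet_Ioc (Set.Ioc_subset_Ioc_left zero_le)
    have hempty : ⋂ r > t, Set.Ioc t r = ∅ := by
      refine Set.eq_empty_of_forall_notMem fun z hz => ?_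
      simp only [Set.mem_iInter, Set.mem_Ioc] at hz
      have h2 := hz (t + 1) (by simp)
      obtain ⟨r, hr, hr'⟩ := exists_between h2.1
      exact absurd (hz r hr).2 (not_le.2 hr')
    rw [hempty, measure_empty] at h1
    filter_upwards [h1.eventually (gt_mem_nhds one_pos)] with b hb
    exact hzero b _ measurableSet_Ioc (Set.Ioc_subset_Ioc_left zero_le) hb
  · have h1 : Tendsto (q ∘ fun c => Set.Ioo (t - c) t) (𝓝[>] 0)
        (𝓝 (q (⋂ r > (0 : ℝ≥0), Set.Ioo (t - r) t))) := by
      refine tendsto_measure_biInter_gt (fun r _ => measurableSet_Ioo.nullMeasurableSet)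
        (fun i j _ hij => Set.Ioo_subset_Ioo_left (tsub_le_tsub_left hij t)) ⟨1, by simp, ?_⟩
      exact hfin t _ measurableSet_Ioo (fun z hz => ⟨zero_le.trans_lt hz.1, hz.2.le⟩)
    have hempty : ⋂ r > (0 : ℝ≥0), Set.Ioo (t - r) t = ∅ := by
      refine Set.eq_empty_of_forall_notMem fun z hz => ?_
      simp only [Set.mem_iInter, Set.mem_Ioo] at hz
      have h2 := hz 1 (by simp)
      have h3 := (hz (t - z) (tsub_pos_of_lt h2.2)).1
      rw [tsub_tsub_cancel_of_le h2.2.le] at h3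
      exact lt_irrefl _ h3
    rw [hempty, measure_empty] at h1
    obtain ⟨c, hc, hc0⟩ := ((h1.eventually (gt_mem_nhds one_pos)).and self_mem_nhdsWithin).exists
    have hc0 : 0 < c := hc0
    have hz := hzero t _ measurableSet_Ioo (fun z hz => ⟨zero_le.trans_lt hz.1, hz.2.le⟩) hc
    rcases eq_zero_or_pos t with rfl | ht
    · have : Set.Iio (0 : ℝ≥0) = ∅ := by ext; simp
      rw [this, nhdsWithin_empty]
      exact eventually_bot
    · filter_upwards [Ioo_mem_nhdsLT (tsub_lt_self ht hc0)] with a ha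
      exact measure_mono_null (Set.Ioo_subset_Ioo_left ha.1.le) hz

/-! ### State processes as jump paths, and bounds on capital and pollution. -/

namespace GrowthModel

variable (m : GrowthModel) {Ω : Type*} {mΩ : MeasurableSpace Ω} {𝓕 : Filtration ℝ≥0 mΩ}
  {μ : Measure Ω} {N : Ω → Measure (ℝ≥0 × ℝ≥0)} {k p : ℝ} {C θ K P : ℝ≥0 → Ω → ℝ}

lemma continuous_intensity : Continuous m.intensity := by
  unfold intensity
  fun_prop

lemma intensity_nonneg {P : ℝ} (hP : 0 ≤ P) : 0 ≤ m.intensity P :=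
  add_nonneg m.lam0_nonneg (mul_nonneg m.lam1_nonneg hP)

lemma intensity_mono {P P' : ℝ} (h : P ≤ P') : m.intensity P ≤ m.intensity P' :=
  add_le_add_right (mul_le_mul_of_nonneg_left h m.lam1_nonneg) _

lemma survival_pos (K P : ℝ) : 0 < m.survival K P := Real.exp_pos _

lemma survival_le_one {K P : ℝ} (hK : 0 ≤ K) (hP : 0 ≤ P) : m.survival K P ≤ 1 := by
  rw [survival, Real.exp_le_one_iff]
  have := mul_nonneg (mul_nonneg m.δ_pos.le (Real.rpow_nonneg hP m.ξ)) (Real.rpow_nonneg hK m.η)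
  linarith [neg_mul m.δ (P ^ m.ξ), neg_mul (m.δ * P ^ m.ξ) (K ^ m.η)]

variable {m}

lemma measurableSet_below_intensity {ω : Ω} (hP : Continuous fun t => P t ω) :
    MeasurableSet {z : ℝ≥0 × ℝ≥0 | (z.2 : ℝ) ≤ m.intensity (P z.1 ω)} :=
  measurableSet_le (NNReal.continuous_coe.comp continuous_snd).measurable
    (m.continuous_intensity.comp (hP.comp continuous_fst)).measurable

lemma arrivals_apply {ω : Ω} {A : Set ℝ≥0}
    (hA : MeasurableSet A) :
    m.arrivals N P ω A
      = N ω (Prod.fst ⁻¹' A ∩ {z : ℝ≥0 × ℝ≥0 | (z.2 : ℝ) ≤ m.intensity (P z.1 ω)}) := by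
  rw [arrivals, Measure.map_apply measurable_fst hA, Measure.restrict_apply (measurable_fst hA)]

/-- Pollution is continuous, so the intensity is bounded on `[0, T]`. The window depends on `ω`,
which the almost sure statements for all `n` allow. -/
lemma exists_below_subset_window {ω : Ω} (hP : Continuous fun t => P t ω) (T : ℝ≥0) :
    ∃ n : ℕ, T ≤ n ∧ ∀ A ⊆ Set.Ioc 0 T,
      Prod.fst ⁻¹' A ∩ {z : ℝ≥0 × ℝ≥0 | (z.2 : ℝ) ≤ m.intensity (P z.1 ω)} ⊆ window n := by
  obtain ⟨b, hb⟩ := (isCompact_Icc (a := (0 : ℝ≥0)) (b := T)).bddAbove_image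
    (m.continuous_intensity.comp hP).continuousOn
  obtain ⟨n, hn⟩ := exists_nat_ge (max (T : ℝ) b)
  refine ⟨n, by exact_mod_cast (le_max_left _ _).trans hn, ?_⟩
  rintro A hA ⟨s, r⟩ ⟨hs, hr⟩
  have hs' : s ∈ Set.Ioc 0 T := hA hs
  have hsn : (s : ℝ) ≤ n := by
    have : (s : ℝ) ≤ T := by exact_mod_cast hs'.2
    exact this.trans ((le_max_left _ _).trans hn)
  refine ⟨⟨hs'.1, by exact_mod_cast hsn⟩, ?_⟩
  have h1 : m.intensity (P s ω) ≤ b := hb ⟨s, ⟨zero_le, hs'.2⟩, rfl⟩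
  have h2 : (r : ℝ) ≤ n := (le_trans hr h1).trans ((le_max_right _ _).trans hn)
  exact Set.mem_Iic.2 (by exact_mod_cast h2)

namespace IsStateSolution

/-- Thinning keeps only points below the intensity; over bounded times these lie in a window, so the
arrivals inherit integer mass and simplicity from `N`. -/
lemma ae_isJumpPath (hX : m.IsStateSolution 𝓕 μ N k p C θ K P)
    (hN : IsPoissonRandomMeasure 𝓕 μ N) :
    ∀ᵐ ω ∂μ, IsJumpPath (m.arrivals N P ω) k p (fun t => K t ω) (fun t => P t ω)
      (fun s => m.driftK (K s ω) (C s ω) (θ s ω))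
      (fun s => m.driftP (K s ω) (P s ω) (θ s ω)) (m.loss K P ω) := by
  filter_upwards [hX.integrable_driftK, hX.integrable_driftP, hX.integrable_loss, hX.eqK, hX.eqP,
    ae_all_iff.2 hN.ae_window_integer, ae_all_iff.2 hN.ae_window_simple]
    with ω h1 h2 h3 h4 h5 hint hsimple
  have hP := hX.continuousP ω
  have hD := measurableSet_below_intensity (m := m) hP
  have hq : ∀ T : ℝ≥0, ∀ A, MeasurableSet A → A ⊆ Set.Ioc 0 T →
      ∃ k : ℕ, m.arrivals N P ω A = k := by
    intro T A hA hAT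
    obtain ⟨n, -, hn⟩ := exists_below_subset_window (m := m) hP T
    obtain ⟨j, hj⟩ := hint n _ ((measurable_fst hA).inter hD)
    exact ⟨j, by rw [arrivals_apply hA, ← hj, Set.inter_eq_left.2 (hn A hAT)]⟩
  refine ⟨(hX.cadlagK ω).2, h1, h2, h3, h4, h5, ?_, fun t => (eventually_measure_Ioc_eq_zero hq t).1,
    fun t => (eventually_measure_Ioc_eq_zero hq t).2⟩
  intro t ht
  have hsub : ({t} : Set ℝ≥0) ⊆ Set.Ioc 0 t := Set.singleton_subset_iff.2 ⟨ht, le_rfl⟩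
  obtain ⟨j, hj⟩ := hq t {t} (measurableSet_singleton t) hsub
  obtain ⟨n, htn, hn⟩ := exists_below_subset_window (m := m) hP t
  have hlt : m.arrivals N P ω {t} < 2 := by
    rw [arrivals_apply (measurableSet_singleton t)]
    refine lt_of_le_of_lt (measure_mono fun z hz => ?_) (hsimple n t ⟨ht, htn⟩)
    exact ⟨hz.1, (hn _ hsub hz).2⟩
  rw [hj] at hlt ⊢
  have : j < 2 := by exact_mod_cast hlt
  interval_cases j <;> simp

lemma leftLim_nonneg (hX : m.IsStateSolution 𝓕 μ N k p C θ K P) (ω : Ω) (t : ℝ≥0) :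
    0 ≤ Function.leftLim (fun u => K u ω) t := by
  rcases eq_zero_or_pos t with rfl | ht
  · rw [leftLim_eq_of_isBot (fun b => zero_le)]
    exact (hX.mem 0 ω).1.le
  · have := nnreal_nhdsLT_neBot ht
    exact ge_of_tendsto' (tendsto_leftLim_of_tendsto ((hX.cadlagK ω).2 t))
      fun u => (hX.mem u ω).1.le

lemma loss_nonneg (hX : m.IsStateSolution 𝓕 μ N k p C θ K P) (ω : Ω) (s : ℝ≥0) :
    0 ≤ m.loss K P ω s :=
  mul_nonneg (sub_nonneg.2 (m.survival_le_one (hX.leftLim_nonneg ω s) (hX.mem s ω).2.le))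
    (hX.leftLim_nonneg ω s)

/-- The left limits of capital are positive. -/
lemma ae_leftLim_pos (hX : m.IsStateSolution 𝓕 μ N k p C θ K P)
    (hN : IsPoissonRandomMeasure 𝓕 μ N) :
    ∀ᵐ ω ∂μ, ∀ t, 0 < Function.leftLim (fun u => K u ω) t := by
  filter_upwards [hX.ae_isJumpPath hN] with ω h t
  refine lt_of_le_of_ne (hX.leftLim_nonneg ω t) fun h0 => ?_
  have hpos : 0 < K t ω := (hX.mem t ω).1
  rcases eq_zero_or_pos t with rfl | ht
  · rw [leftLim_eq_of_isBot (fun b => zero_le)] at h0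
    exact hpos.ne h0
  · have h1 := h.jump_relation ht
    rw [loss, ← h0] at h1
    simp only [mul_zero, sub_zero] at h1
    exact hpos.ne' h1

/-- Capital never exceeds the level reached without consumption, abatement and disasters. -/
lemma ae_capital_le (hX : m.IsStateSolution 𝓕 μ N k p C θ K P)
    (hN : IsPoissonRandomMeasure 𝓕 μ N) (hC : ∀ᵐ ω ∂μ, ∀ᵐ t ∂lebNN, 0 ≤ C t ω)
    (hθ : ∀ᵐ ω ∂μ, ∀ᵐ t ∂lebNN, 0 ≤ θ t ω) :
    ∀ᵐ ω ∂μ, ∀ t : ℝ≥0, K t ω ≤ k * Real.exp (m.A * t) := by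
  filter_upwards [hX.ae_isJumpPath hN, hX.ae_leftLim_pos hN, hC, hθ] with ω h hpos hCω hθω t
  -- The change-of-variables formula for `v(K, P) = K` with discount rate `A`: consumption,
  -- abatement and disasters can only lower `e^{-At} K`.
  have hv : ContDiffOn ℝ 2 (Prod.fst : ℝ × ℝ → ℝ) stateSpace := contDiff_fst.contDiffOn
  have hito := h.ito hv m.A (fun t => hX.mem t ω) hpos t
  have h1 : ∫ s in Set.Iic t, discountedDrift Prod.fst m.A s (K s ω) (P s ω)
      (m.driftK (K s ω) (C s ω) (θ s ω)) (m.driftP (K s ω) (P s ω) (θ s ω)) ∂lebNN ≤ 0 := by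
    refine integral_nonpos_of_ae (ae_restrict_of_ae ?_)
    filter_upwards [hCω, hθω] with s hc hθs
    simp only [discountedDrift, driftK, deriv_id'', deriv_const', Pi.zero_apply]
    refine mul_nonpos_of_nonneg_of_nonpos (Real.exp_pos _).le ?_
    have := mul_nonneg hθs (mul_nonneg m.A_pos.le (hX.mem s ω).1.le)
    nlinarith
  have h2 : ∫ s in Set.Ioc 0 t, IsJumpPath.jumpIncrement Prod.fst m.A (fun t => K t ω)
      (fun t => P t ω) (m.loss K P ω) s ∂(m.arrivals N P ω) ≤ 0 := by
    refine integral_nonpos fun s => ?_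
    simp only [IsJumpPath.jumpIncrement, Pi.zero_apply]
    refine mul_nonpos_of_nonneg_of_nonpos (Real.exp_pos _).le ?_
    linarith [hX.loss_nonneg ω s]
  have h3 : Real.exp (-m.A * t) * K t ω ≤ k := by linarith
  have h4 : Real.exp (m.A * t) * Real.exp (-m.A * t) = 1 := by
    rw [← Real.exp_add]; simp
  calc K t ω = Real.exp (m.A * t) * (Real.exp (-m.A * t) * K t ω) := by
        rw [← mul_assoc, h4, one_mul]
    _ ≤ Real.exp (m.A * t) * k := by gcongr
    _ = _ := mul_comm _ _

/-- Pollution is bounded on bounded time intervals. -/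
lemma ae_pollution_le (hX : m.IsStateSolution 𝓕 μ N k p C θ K P)
    (hN : IsPoissonRandomMeasure 𝓕 μ N) (hC : ∀ᵐ ω ∂μ, ∀ᵐ t ∂lebNN, 0 ≤ C t ω)
    (hθ : ∀ᵐ ω ∂μ, ∀ᵐ t ∂lebNN, 0 ≤ θ t ω) (hk : 0 < k) :
    ∀ᵐ ω ∂μ, ∀ t : ℝ≥0,
      P t ω ≤ p + t * (m.φ * (m.A * (k * Real.exp (m.A * t)))) := by
  filter_upwards [hX.eqP, hX.integrable_driftP, hX.ae_capital_le hN hC hθ, hθ]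
    with ω h hi hK hθω t
  rw [h t]
  gcongr
  have h1 : ∫ s in Set.Iic t, m.driftP (K s ω) (P s ω) (θ s ω) ∂lebNN
      -- Abatement and decay are dropped, and capital is replaced by its bound at the final time.
      ≤ ∫ _ in Set.Iic t, m.φ * (m.A * (k * Real.exp (m.A * t))) ∂lebNN := by
    refine integral_mono_ae (hi t) (integrableOn_const (by simp [lebNN_Iic])) ?_
    refine (ae_restrict_iff' measurableSet_Iic).2 ?_
    filter_upwards [hθω] with s hθs hs
    have hKs : K s ω ≤ k * Real.exp (m.A * t) := by
      refine (hK s).trans ?_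
      have : (s : ℝ) ≤ t := by exact_mod_cast hs
      have hA := m.A_pos
      gcongr
    have hK0 : 0 < K s ω := (hX.mem s ω).1
    have hP0 : 0 < P s ω := (hX.mem s ω).2
    have e1 : (m.φ - m.σ * θ s ω) * (m.A * K s ω) ≤ m.φ * (m.A * K s ω) := by
      have := mul_nonneg m.A_pos.le hK0.le
      have := mul_nonneg m.σ_pos.le hθs
      nlinarith
    have e2 : m.φ * (m.A * K s ω) ≤ m.φ * (m.A * (k * Real.exp (m.A * t))) := by
      have := m.A_pos
      have := m.φ_pos
      gcongr
    have e3 := mul_nonneg m.α_nonneg hP0.le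
    simp only [driftP]
    linarith
  refine h1.trans_eq ?_
  rw [setIntegral_const, Measure.real, lebNN_Iic]
  simp

end IsStateSolution
end GrowthModel

/-! ### Compensation of the jumps of the discounted value. -/

lemma measurableSet_stateSpace : MeasurableSet stateSpace := isOpen_stateSpace.measurableSet

lemma measurable_indicator_stateSpace {v : ℝ × ℝ → ℝ} (hv : ContinuousOn v stateSpace) :
    Measurable (stateSpace.indicator v) := by
  classical
  rw [← Set.piecewise_eq_indicator]
  exact hv.measurable_piecewise continuousOn_const measurableSet_stateSpace

namespace GrowthModel

variable (m : GrowthModel)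

lemma measurable_survival : Measurable fun x : ℝ × ℝ => m.survival x.1 x.2 := by
  unfold survival
  fun_prop

/-- The discounted change of value at a disaster, for a value function cut off outside the
rectangle `(0, a] × (0, b]`. -/
def disasterChange (v : ℝ × ℝ → ℝ) (a b s K P : ℝ) : ℝ :=
  (Set.Ioc 0 a ×ˢ Set.Ioc 0 b).indicator (fun x : ℝ × ℝ => Real.exp (-m.ρ * s) *
    (stateSpace.indicator v (m.survival x.1 x.2 * x.1, x.2) - stateSpace.indicator v x)) (K, P)

lemma measurable_disasterChange {v : ℝ × ℝ → ℝ} (hv : ContinuousOn v stateSpace) (a b : ℝ) :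
    Measurable fun z : ℝ × ℝ × ℝ => m.disasterChange v a b z.1 z.2.1 z.2.2 := by
  have hvm := measurable_indicator_stateSpace hv
  have hs := m.measurable_survival
  have h1 : Measurable fun z : ℝ × ℝ × ℝ => Real.exp (-m.ρ * z.1) *
      (stateSpace.indicator v (m.survival z.2.1 z.2.2 * z.2.1, z.2.2)
        - stateSpace.indicator v z.2) := by
    refine (Real.measurable_exp.comp (measurable_const.mul measurable_fst)).mul
      ((hvm.comp (Measurable.prodMk ?_ ?_)).sub (hvm.comp measurable_snd))
    · exact (hs.comp measurable_snd).mul (measurable_fst.comp measurable_snd)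
    · exact measurable_snd.comp measurable_snd
  exact h1.indicator (measurable_snd (measurableSet_Ioc.prod measurableSet_Ioc))

lemma disasterChange_eq {v : ℝ × ℝ → ℝ} {a b s K P : ℝ} (hK : K ∈ Set.Ioc 0 a)
    (hP : P ∈ Set.Ioc 0 b) : m.disasterChange v a b s K P
      = Real.exp (-m.ρ * s) * (v (m.survival K P * K, P) - v (K, P)) := by
  rw [disasterChange, Set.indicator_of_mem (Set.mk_mem_prod hK hP), Set.indicator_of_mem,
    Set.indicator_of_mem]
  · exact ⟨hK.1, hP.1⟩
  · exact ⟨mul_pos (m.survival_pos K P) hK.1, hP.1⟩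

/-- The only use of polynomial growth: the rectangle reaches the axes, so continuity inside the
quadrant would not bound `v` on it. -/
lemma exists_value_bound {v : ℝ × ℝ → ℝ} (hv : PolynomialGrowth v) (a b : ℝ) :
    ∃ B, 0 ≤ B ∧ ∀ K P, K ∈ Set.Ioc 0 a → P ∈ Set.Ioc 0 b → |v (K, P)| ≤ B := by
  obtain ⟨c, γ, d, hc, hγ, hd, h⟩ := hv
  refine ⟨c * (1 + |a| ^ γ + |b| ^ d), by positivity, fun K P hK hP => ?_⟩
  refine (h K P hK.1 hP.1).trans ?_
  have h1 : K ^ γ ≤ |a| ^ γ := Real.rpow_le_rpow hK.1.le (hK.2.trans (le_abs_self a)) hγ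
  have h2 : P ^ d ≤ |b| ^ d := Real.rpow_le_rpow hP.1.le (hP.2.trans (le_abs_self b)) hd
  gcongr

lemma abs_disasterChange_le {v : ℝ × ℝ → ℝ} {a b B : ℝ} (hB0 : 0 ≤ B)
    (hB : ∀ K P, K ∈ Set.Ioc 0 a → P ∈ Set.Ioc 0 b → |v (K, P)| ≤ B) {s : ℝ} (hs : 0 ≤ s)
    (K P : ℝ) : |m.disasterChange v a b s K P| ≤ 2 * B := by
  by_cases h : K ∈ Set.Ioc 0 a ∧ P ∈ Set.Ioc 0 b
  · rw [m.disasterChange_eq h.1 h.2, abs_mul, Real.abs_exp]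
    have h1 : Real.exp (-m.ρ * s) ≤ 1 := by
      rw [Real.exp_le_one_iff]
      nlinarith [m.ρ_pos]
    have h2 : |v (m.survival K P * K, P) - v (K, P)| ≤ 2 * B := by
      -- A disaster lowers capital, so the state stays in the rectangle where `v` is bounded.
      have hK' : m.survival K P * K ∈ Set.Ioc 0 a :=
        ⟨mul_pos (m.survival_pos K P) h.1.1,
          (mul_le_of_le_one_left h.1.1.le (m.survival_le_one h.1.1.le h.2.1.le)).trans h.1.2⟩
      have e1 := hB _ _ hK' h.2
      have e2 := hB _ _ h.1 h.2
      refine (abs_sub _ _).trans ?_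
      linarith
    calc _ ≤ 1 * (2 * B) := by gcongr
      _ = _ := one_mul _
  · rw [disasterChange, Set.indicator_of_notMem (show (K, P) ∉ Set.Ioc 0 a ×ˢ Set.Ioc 0 b from h)]
    simpa using hB0

lemma lebNN_below (n : ℕ) {c : ℝ} (hc : 0 ≤ c) (hcn : c ≤ n) :
    lebNN (Set.Iic (n : ℝ≥0) ∩ {r : ℝ≥0 | (r : ℝ) ≤ c}) = ENNReal.ofReal c := by
  have : Set.Iic (n : ℝ≥0) ∩ {r : ℝ≥0 | (r : ℝ) ≤ c} = Set.Iic c.toNNReal := by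
    ext r
    simp only [Set.mem_inter_iff, Set.mem_Iic, Set.mem_ofPred_eq, Real.le_toNNReal_iff_coe_le hc,
      and_iff_right_iff_imp]
    intro h
    exact_mod_cast h.trans hcn
  rw [this, lebNN_Iic]
  rfl

/-- Integrating over the levels below a graph. -/
lemma setIntegral_window_below {n : ℕ} {T : ℝ≥0} (hTn : T ≤ n) {ψ c : ℝ≥0 → ℝ}
    (hψ : Measurable ψ) {M : ℝ} (hM : ∀ s, |ψ s| ≤ M) (hc : Measurable c)
    (hc0 : ∀ s ∈ Set.Ioc 0 T, 0 ≤ c s) (hcn : ∀ s ∈ Set.Ioc 0 T, c s ≤ n) :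
    ∫ z in window n, (Prod.fst ⁻¹' Set.Ioc 0 T ∩ {z : ℝ≥0 × ℝ≥0 | (z.2 : ℝ) ≤ c z.1}).indicator
        (fun z => ψ z.1) z ∂(lebNN.prod lebNN)
      = ∫ s in Set.Ioc 0 T, c s * ψ s ∂lebNN := by
  have hset : MeasurableSet
      (Prod.fst ⁻¹' Set.Ioc 0 T ∩ {z : ℝ≥0 × ℝ≥0 | (z.2 : ℝ) ≤ c z.1}) :=
    (measurable_fst measurableSet_Ioc).inter (measurableSet_le
      (NNReal.continuous_coe.measurable.comp measurable_snd) (hc.comp measurable_fst))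
  have hfin : IsFiniteMeasure ((lebNN.prod lebNN).restrict (window n)) :=
    ⟨by rw [Measure.restrict_apply_univ]; exact (prod_window_ne_top n).lt_top⟩
  have hint : IntegrableOn ((Prod.fst ⁻¹' Set.Ioc 0 T ∩
      {z : ℝ≥0 × ℝ≥0 | (z.2 : ℝ) ≤ c z.1}).indicator (fun z => ψ z.1)) (window n)
      (lebNN.prod lebNN) :=
    (Integrable.of_bound (hψ.comp measurable_fst).aestronglyMeasurable M
      (ae_of_all _ fun z => hM z.1)).indicator hset
  rw [window, setIntegral_prod _ hint]
  have hinner : ∀ s ∈ Set.Ioc 0 (n : ℝ≥0), ∫ r in Set.Iic (n : ℝ≥0), (Prod.fst ⁻¹' Set.Ioc 0 T ∩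
      {z : ℝ≥0 × ℝ≥0 | (z.2 : ℝ) ≤ c z.1}).indicator (fun z => ψ z.1) (s, r) ∂lebNN
      = (Set.Ioc 0 T).indicator (fun s => c s * ψ s) s := by
    intro s _
    by_cases hs : s ∈ Set.Ioc 0 T
    · have e : ∀ r : ℝ≥0, (Prod.fst ⁻¹' Set.Ioc 0 T ∩
          {z : ℝ≥0 × ℝ≥0 | (z.2 : ℝ) ≤ c z.1}).indicator (fun z => ψ z.1) (s, r)
          = {r : ℝ≥0 | (r : ℝ) ≤ c s}.indicator (fun _ => ψ s) r := by
        intro r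
        by_cases hr : (r : ℝ) ≤ c s
        · rw [Set.indicator_of_mem (show r ∈ {r : ℝ≥0 | (r : ℝ) ≤ c s} from hr),
            Set.indicator_of_mem (show (s, r) ∈ Prod.fst ⁻¹' Set.Ioc 0 T ∩
              {z : ℝ≥0 × ℝ≥0 | (z.2 : ℝ) ≤ c z.1} from ⟨hs, hr⟩)]
        · rw [Set.indicator_of_notMem (show r ∉ {r : ℝ≥0 | (r : ℝ) ≤ c s} from hr),
            Set.indicator_of_notMem (fun h => hr h.2)]
      simp_rw [e]
      rw [setIntegral_indicator (measurableSet_le NNReal.continuous_coe.measurable measurable_const),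
        setIntegral_const, Measure.real, lebNN_below n (hc0 s hs) (hcn s hs),
        ENNReal.toReal_ofReal (hc0 s hs), Set.indicator_of_mem hs, smul_eq_mul]
    · rw [Set.indicator_of_notMem hs]
      refine (setIntegral_congr_fun measurableSet_Iic fun r _ => ?_).trans (integral_zero _ _)
      exact Set.indicator_of_notMem (fun h => hs h.1) _
  rw [setIntegral_congr_fun measurableSet_Ioc hinner, setIntegral_indicator measurableSet_Ioc,
    Set.inter_eq_right.2 (Set.Ioc_subset_Ioc_right hTn)]

variable {m} {Ω : Type*} {mΩ : MeasurableSpace Ω} {𝓕 : Filtration ℝ≥0 mΩ}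
  {μ : Measure Ω} {N : Ω → Measure (ℝ≥0 × ℝ≥0)} {k p : ℝ} {C θ K P : ℝ≥0 → Ω → ℝ}

lemma leftLimProcess_of_continuous {X : ℝ≥0 → Ω → ℝ} {ω : Ω} (h : Continuous fun t => X t ω)
    {s : ℝ≥0} (hs : 0 < s) (r : ℝ≥0) : leftLimProcess X (ω, (s, r)) = X s ω := by
  rw [leftLimProcess_of_pos _ _ hs]
  exact h.continuousWithinAt.leftLim_eq

/-- The drift of `e^{-ρ s} v(K_s, P_s)` after compensation of the jumps. -/
def valueDrift (m : GrowthModel) (v : ℝ × ℝ → ℝ) (C θ K P : ℝ≥0 → Ω → ℝ) (ω : Ω) (s : ℝ≥0) : ℝ :=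
  Real.exp (-m.ρ * s) * (m.generator v (C s ω) (θ s ω) (K s ω) (P s ω) - m.ρ * v (K s ω, P s ω))

/-- `M` is the jump integral minus its compensator. The deterministic state bounds up to `T` show
that the cut-off integrand, bounded and predictable, is almost surely the true one. -/
lemma IsStateSolution.exists_martingale_part [IsProbabilityMeasure μ]
    (hX : m.IsStateSolution 𝓕 μ N k p C θ K P)
    (hN : IsPoissonRandomMeasure 𝓕 μ N) (hC : ∀ᵐ ω ∂μ, ∀ᵐ t ∂lebNN, 0 ≤ C t ω)
    (hθ : ∀ᵐ ω ∂μ, ∀ᵐ t ∂lebNN, 0 ≤ θ t ω) (hk : 0 < k) {v : ℝ × ℝ → ℝ}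
    (hv : ContDiffOn ℝ 2 v stateSpace) (hgrowth : PolynomialGrowth v) (T : ℝ≥0) :
    ∃ M : Ω → ℝ, Integrable M μ ∧ ∫ ω, M ω ∂μ = 0 ∧
      ∀ᵐ ω ∂μ, IntegrableOn (m.valueDrift v C θ K P ω) (Set.Iic T) lebNN ∧
        Real.exp (-m.ρ * T) * v (K T ω, P T ω)
          = v (k, p) + (∫ s in Set.Iic T, m.valueDrift v C θ K P ω s ∂lebNN) + M ω := by
  -- The bounds of `ae_capital_le` and `ae_pollution_le` at time `T`; `n` exceeds `T` and the
  -- largest intensity, so one deterministic window holds all disasters up to `T`.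
  set a : ℝ := k * Real.exp (m.A * T) with ha
  set b : ℝ := p + T * (m.φ * (m.A * (k * Real.exp (m.A * T)))) with hb
  obtain ⟨B, hB0, hB⟩ := exists_value_bound hgrowth a b
  obtain ⟨n, hn⟩ := exists_nat_ge (max (T : ℝ) (m.intensity b))
  have hTn : T ≤ n := by exact_mod_cast (le_max_left _ _).trans hn
  have hbn : m.intensity b ≤ n := (le_max_right _ _).trans hn
  have hKm := measurable_leftLimProcess hX.adaptedK fun ω => (hX.cadlagK ω).2
  have hPm := measurable_leftLimProcess hX.adaptedP fun ω t =>
    ⟨_, ((hX.continuousP ω).tendsto t).mono_left nhdsWithin_le_nhds⟩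
  have hsnd := measurable_snd_predictableLevel 𝓕
  have hdc := m.measurable_disasterChange hv.continuousOn a b
  set Ψ : Ω × (ℝ≥0 × ℝ≥0) → ℝ := fun z =>
    m.disasterChange v a b z.2.1 (leftLimProcess K z) (leftLimProcess P z) with hΨ
  have hΨm : Measurable[predictableLevel 𝓕] Ψ :=
    hdc.comp ((NNReal.continuous_coe.measurable.comp (measurable_fst.comp hsnd)).prodMk
      (hKm.prodMk hPm))
  set G : Set (Ω × (ℝ≥0 × ℝ≥0)) := {z | z.2.1 ∈ Set.Ioc 0 T ∧
    (z.2.2 : ℝ) ≤ m.intensity (leftLimProcess P z)} with hG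
  have hGm : MeasurableSet[predictableLevel 𝓕] G := by
    have hsub : Measurable[predictableLevel 𝓕] fun z : Ω × (ℝ≥0 × ℝ≥0) =>
        (z.2.2 : ℝ) - m.intensity (leftLimProcess P z) :=
      (NNReal.continuous_coe.measurable.comp (measurable_snd.comp hsnd)).sub
        (m.continuous_intensity.measurable.comp hPm)
    have hset : G = (fun z : Ω × (ℝ≥0 × ℝ≥0) => z.2.1) ⁻¹' Set.Ioc 0 T ∩
        (fun z : Ω × (ℝ≥0 × ℝ≥0) => (z.2.2 : ℝ) - m.intensity (leftLimProcess P z)) ⁻¹'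
          Set.Iic 0 := by
      ext z
      simp [hG]
    rw [hset]
    exact ((measurable_fst.comp hsnd) measurableSet_Ioc).inter (hsub measurableSet_Iic)
  have hHm : Measurable[predictableLevel 𝓕] (G.indicator Ψ) := hΨm.indicator hGm
  have hΨb : ∀ z, |Ψ z| ≤ 2 * B := fun z => m.abs_disasterChange_le hB0 hB z.2.1.2 _ _
  have hHb : ∀ z, |G.indicator Ψ z| ≤ 2 * B := by
    intro z
    by_cases hz : z ∈ G
    · rw [Set.indicator_of_mem hz]
      exact hΨb z
    · rw [Set.indicator_of_notMem hz]
      simpa using hB0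
  obtain ⟨hi1, hi2, heq⟩ := hN.compensation n hHm hHb
  refine ⟨fun ω => (∫ z in window n, G.indicator Ψ (ω, z) ∂(N ω))
    - ∫ z in window n, G.indicator Ψ (ω, z) ∂(lebNN.prod lebNN), hi1.sub hi2, ?_, ?_⟩
  · rw [integral_sub hi1 hi2, heq, sub_self]
  filter_upwards [hX.ae_isJumpPath hN, hX.ae_leftLim_pos hN, hX.ae_capital_le hN hC hθ,
    hX.ae_pollution_le hN hC hθ hk] with ω hjump hpos hKle hPle
  have hPc := hX.continuousP ω
  have hKT : ∀ s ∈ Set.Ioc 0 T, K s ω ∈ Set.Ioc 0 a := by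
    intro s hs
    refine ⟨(hX.mem s ω).1, (hKle s).trans ?_⟩
    have h1 : (s : ℝ) ≤ T := by exact_mod_cast hs.2
    have h2 := m.A_pos
    rw [ha]
    gcongr
  have hKLT : ∀ s ∈ Set.Ioc 0 T, Function.leftLim (fun u => K u ω) s ∈ Set.Ioc 0 a := by
    intro s hs
    refine ⟨hpos s, ?_⟩
    have := nnreal_nhdsLT_neBot hs.1
    refine le_of_tendsto (tendsto_leftLim_of_tendsto ((hX.cadlagK ω).2 s)) ?_
    filter_upwards [Ioo_mem_nhdsLT hs.1] with u hu
    exact (hKT u ⟨hu.1, hu.2.le.trans hs.2⟩).2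
  have hPT : ∀ s ∈ Set.Ioc 0 T, P s ω ∈ Set.Ioc 0 b := by
    intro s hs
    refine ⟨(hX.mem s ω).2, (hPle s).trans ?_⟩
    have h1 : (s : ℝ) ≤ T := by exact_mod_cast hs.2
    have h2 := m.A_pos
    have h3 := m.φ_pos
    rw [hb]
    gcongr
  -- `Ψ` does not depend on the level, so level `0` stands for all; the level enters only through
  -- `G`.
  set ψ : ℝ≥0 → ℝ := fun s => Ψ (ω, (s, 0)) with hψ
  have hψm : Measurable ψ := (hΨm.mono (predictableLevel_le 𝓕) le_rfl).comp
    (measurable_prodMk_left.comp measurable_prodMk_right)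
  have hψeq : ∀ s ∈ Set.Ioc 0 T, ψ s = IsJumpPath.jumpIncrement v m.ρ (fun t => K t ω)
      (fun t => P t ω) (m.loss K P ω) s := by
    intro s hs
    simp only [hψ, hΨ]
    rw [leftLimProcess_of_pos _ _ hs.1, leftLimProcess_of_continuous hPc hs.1,
      m.disasterChange_eq (hKLT s hs) (hPT s hs), IsJumpPath.jumpIncrement, loss]
    congr 4
    ring
  have hHind : ∀ z, G.indicator Ψ (ω, z) = (Prod.fst ⁻¹' Set.Ioc 0 T ∩
      {z : ℝ≥0 × ℝ≥0 | (z.2 : ℝ) ≤ m.intensity (P z.1 ω)}).indicator (fun z => ψ z.1) z := by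
    rintro ⟨s, r⟩
    by_cases h : s ∈ Set.Ioc 0 T ∧ (r : ℝ) ≤ m.intensity (P s ω)
    · rw [Set.indicator_of_mem (show (s, r) ∈ Prod.fst ⁻¹' Set.Ioc 0 T ∩
        {z : ℝ≥0 × ℝ≥0 | (z.2 : ℝ) ≤ m.intensity (P z.1 ω)} from h), Set.indicator_of_mem]
      · rfl
      · exact ⟨h.1, by rw [leftLimProcess_of_continuous hPc h.1.1]; exact h.2⟩
    · rw [Set.indicator_of_notMem (show (s, r) ∉ Prod.fst ⁻¹' Set.Ioc 0 T ∩
        {z : ℝ≥0 × ℝ≥0 | (z.2 : ℝ) ≤ m.intensity (P z.1 ω)} from h), Set.indicator_of_notMem]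
      rintro ⟨h1, h2⟩
      rw [leftLimProcess_of_continuous hPc (Set.mem_Ioc.1 h1).1] at h2
      exact h ⟨h1, h2⟩
  have hDm := measurableSet_below_intensity (m := m) hPc
  have hsub : Prod.fst ⁻¹' Set.Ioc 0 T ∩
      {z : ℝ≥0 × ℝ≥0 | (z.2 : ℝ) ≤ m.intensity (P z.1 ω)} ⊆ window n := by
    rintro ⟨s, r⟩ ⟨hs, hr⟩
    have hs : s ∈ Set.Ioc 0 T := hs
    have h1 : (r : ℝ) ≤ n := (le_trans hr (m.intensity_mono (hPT s hs).2)).trans hbn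
    exact ⟨⟨hs.1, hs.2.trans hTn⟩, Set.mem_Iic.2 (by exact_mod_cast h1)⟩
  have hN1 : ∫ z in window n, G.indicator Ψ (ω, z) ∂(N ω)
      = ∫ s in Set.Ioc 0 T, IsJumpPath.jumpIncrement v m.ρ (fun t => K t ω)
      (fun t => P t ω) (m.loss K P ω) s ∂(m.arrivals N P ω) := by
    simp_rw [hHind]
    rw [setIntegral_indicator ((measurable_fst measurableSet_Ioc).inter hDm),
      Set.inter_eq_right.2 hsub, ← setIntegral_congr_fun measurableSet_Ioc hψeq, arrivals,
      setIntegral_map measurableSet_Ioc hψm.aestronglyMeasurable measurable_fst.aemeasurable,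
      Measure.restrict_restrict (measurable_fst measurableSet_Ioc)]
  have hN2 : ∫ z in window n, G.indicator Ψ (ω, z) ∂(lebNN.prod lebNN)
      = ∫ s in Set.Ioc 0 T, m.intensity (P s ω) * ψ s ∂lebNN := by
    simp_rw [hHind]
    exact setIntegral_window_below (c := fun s => m.intensity (P s ω)) hTn hψm (fun s => hΨb _)
      (m.continuous_intensity.comp hPc).measurable
      (fun s hs => m.intensity_nonneg (hPT s hs).1.le)
      (fun s hs => (m.intensity_mono (hPT s hs).2).trans hbn)
  have hcomp : IntegrableOn (fun s => m.intensity (P s ω) * ψ s) (Set.Ioc 0 T) lebNN := by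
    have hfin : IsFiniteMeasure (lebNN.restrict (Set.Ioc 0 T)) :=
      ⟨by rw [Measure.restrict_apply_univ, lebNN_Ioc]; exact ENNReal.coe_lt_top⟩
    refine Integrable.of_bound ((m.continuous_intensity.comp hPc).measurable.mul
      hψm).aestronglyMeasurable (n * (2 * B)) ?_
    filter_upwards [ae_restrict_mem measurableSet_Ioc] with s hs
    have h0 := m.intensity_nonneg (hPT s hs).1.le
    have h1 := (m.intensity_mono (hPT s hs).2).trans hbn
    rw [norm_mul, Real.norm_of_nonneg h0]
    exact mul_le_mul h1 (hΨb _) (norm_nonneg _) (h0.trans h1)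
  have hdrift := (hjump.integrableOn_discountedDrift hv m.ρ (fun t => hX.mem t ω) hpos T)
  -- For almost every time the left limit of capital is its value, so drift plus compensator form
  -- the generator.
  have hae : ∀ᵐ s : ℝ≥0 ∂lebNN.restrict (Set.Iic T), discountedDrift v m.ρ s (K s ω) (P s ω)
      (m.driftK (K s ω) (C s ω) (θ s ω)) (m.driftP (K s ω) (P s ω) (θ s ω))
      + m.intensity (P s ω) * ψ s = m.valueDrift v C θ K P ω s := by
    rw [restrict_lebNN_Iic]
    filter_upwards [ae_restrict_of_ae hjump.ae_leftLim_eq, ae_restrict_mem measurableSet_Ioc]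
      with s hsl hs
    have hψs : ψ s = Real.exp (-m.ρ * s) *
        (v (m.survival (K s ω) (P s ω) * K s ω, P s ω) - v (K s ω, P s ω)) := by
      simp only [hψ, hΨ]
      rw [leftLimProcess_of_pos _ _ hs.1, leftLimProcess_of_continuous hPc hs.1, hsl,
        m.disasterChange_eq (hKT s hs) (hPT s hs)]
    rw [hψs, discountedDrift, valueDrift, generator]
    ring
  rw [← restrict_lebNN_Iic] at hN2
  rw [IntegrableOn, ← restrict_lebNN_Iic] at hcomp
  refine ⟨(hdrift.add hcomp).congr hae, ?_⟩
  rw [← integral_congr_ae hae, integral_add hdrift hcomp, hN1, hN2,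
    hjump.ito hv m.ρ (fun t => hX.mem t ω) hpos T]
  ring

end GrowthModel

/-! ### Verification: from the HJB equation and transversality to the gain. -/

lemma MeasureTheory.IsProgressive.measurable_uncurry_swap {Ω : Type*} {mΩ : MeasurableSpace Ω}
    {𝓕 : Filtration ℝ≥0 mΩ} {X : ℝ≥0 → Ω → ℝ} (hX : IsProgressive 𝓕 X) :
    Measurable fun z : Ω × ℝ≥0 => X z.2 z.1 := by
  have h : ∀ n : ℕ, Measurable fun z : Ω × ℝ≥0 => X (min z.2 n) z.1 := by
    intro n
    have h1 : Measurable fun w : Set.Iic (n : ℝ≥0) × Ω => X w.1 w.2 :=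
      (hX n).mono (sup_le_sup le_rfl (MeasurableSpace.comap_mono (𝓕.le n))) le_rfl
    have h2 : Measurable fun z : Ω × ℝ≥0 => ((⟨min z.2 n, Set.mem_Iic.2 (min_le_right _ _)⟩, z.1) :
        Set.Iic (n : ℝ≥0) × Ω) :=
      ((measurable_snd.min measurable_const).subtype_mk).prodMk measurable_fst
    exact h1.comp h2
  refine measurable_of_tendsto_metrizable h (tendsto_pi_nhds.2 fun z => ?_)
  refine tendsto_const_nhds.congr' ?_
  obtain ⟨n, hn⟩ := exists_nat_ge z.2
  filter_upwards [eventually_ge_atTop n] with j hj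
  rw [min_eq_left (hn.trans (by exact_mod_cast hj))]

lemma EReal.enorm_toReal_le_abs (x : EReal) : ‖x.toReal‖ₑ ≤ x.abs := by
  induction x with
  | bot => simp
  | top => simp
  | coe x => rw [EReal.toReal_coe, EReal.abs_def, Real.enorm_eq_ofReal_abs]

lemma EReal.measurable_abs : Measurable EReal.abs := by
  refine EReal.measurable_of_measurable_real ?_
  simp only [EReal.abs_def]
  fun_prop

namespace GrowthModel

variable (m : GrowthModel)

lemma measurable_utility : Measurable fun x : ℝ × ℝ => m.utility x.1 x.2 := by
  unfold utility
  refine Measurable.ite ?_ measurable_const ?_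
  · exact (measurable_fst (measurableSet_singleton 0)).inter (MeasurableSet.const _)
  · refine measurable_coe_real_ereal.comp ?_
    fun_prop

lemma utility_ne_top (C P : ℝ) : m.utility C P ≠ ⊤ := by
  unfold utility
  split_ifs
  · exact bot_ne_top
  · exact EReal.coe_ne_top _

/-- The discounted utility flow of a control with pollution path `P`. -/
def utilityFlow {Ω : Type*} (C P : ℝ≥0 → Ω → ℝ) (z : Ω × ℝ≥0) : ℝ :=
  Real.exp (-m.ρ * z.2) * (m.utility (C z.2 z.1) (P z.2 z.1)).toReal

variable {m} {Ω : Type*} {mΩ : MeasurableSpace Ω} {𝓕 : Filtration ℝ≥0 mΩ}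
  {μ : Measure Ω} {N : Ω → Measure (ℝ≥0 × ℝ≥0)} {k p : ℝ} {C θ K P : ℝ≥0 → Ω → ℝ}
  {v : ℝ × ℝ → ℝ}

/-- Finite utility is assumed because `toReal` sends `⊥` to `0`, for which the real inequality may
fail. -/
lemma SolvesHJB.utility_add_generator_le (hHJB : m.SolvesHJB v) {K P C θ : ℝ} (hK : 0 < K)
    (hP : 0 < P) (hC : 0 ≤ C) (hθ : θ ∈ Set.Icc 0 m.thetaBar) (hU : m.utility C P ≠ ⊥) :
    (m.utility C P).toReal + m.generator v C θ K P ≤ m.ρ * v (K, P) := by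
  have h : m.utility C P + (m.generator v C θ K P : EReal) ≤ ((m.ρ * v (K, P) : ℝ) : EReal) := by
    rw [hHJB K P hK hP]
    exact le_iSup₂ (f := fun (a : ℝ × ℝ) (_ : a ∈ m.controlValues) =>
      m.utility a.1 P + (m.generator v a.1 a.2 K P : EReal)) (C, θ) ⟨hC, hθ⟩
  rw [← EReal.coe_toReal (m.utility_ne_top C P) hU] at h
  exact_mod_cast h

lemma SolvesHJB.utility_add_generator_eq (hHJB : m.SolvesHJB v) {K P C θ : ℝ} (hK : 0 < K)
    (hP : 0 < P)
    (h : m.utility C P + (m.generator v C θ K P : EReal) = m.hjbSup v K P) :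
    (m.utility C P).toReal + m.generator v C θ K P = m.ρ * v (K, P) := by
  rw [← hHJB K P hK hP] at h
  have hU : m.utility C P ≠ ⊥ := by
    intro h0
    rw [h0, EReal.bot_add] at h
    exact EReal.coe_ne_bot _ h.symm
  rw [← EReal.coe_toReal (m.utility_ne_top C P) hU] at h
  exact_mod_cast h

namespace IsAdmissible

lemma measurable_utilityProcess (hA : m.IsAdmissible 𝓕 μ N k p C θ)
    (hX : m.IsStateSolution 𝓕 μ N k p C θ K P) :
    Measurable fun z : Ω × ℝ≥0 => m.utility (C z.2 z.1) (P z.2 z.1) := by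
  have hP : Measurable fun z : Ω × ℝ≥0 => P z.2 z.1 :=
    (measurable_uncurry_of_continuous_of_measurable hX.continuousP
      (fun t => (hX.adaptedP t).mono (𝓕.le t) le_rfl)).comp measurable_swap
  exact m.measurable_utility.comp (hA.progC.measurable_uncurry_swap.prodMk hP)

lemma lintegral_utility_lt_top [SFinite μ] (hA : m.IsAdmissible 𝓕 μ N k p C θ)
    (hX : m.IsStateSolution 𝓕 μ N k p C θ K P) :
    ∫⁻ z, ENNReal.ofReal (Real.exp (-m.ρ * z.2)) * (m.utility (C z.2 z.1) (P z.2 z.1)).abs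
      ∂(μ.prod lebNN) < ∞ := by
  rw [lintegral_prod]
  · exact hA.integrable_utility K P hX
  · have := hA.measurable_utilityProcess hX
    have habs := EReal.measurable_abs
    fun_prop

/-- A finite expected integral of discounted `|U|` excludes infinite values, the discount factor
being positive. -/
lemma ae_utility_ne_bot [SFinite μ] (hA : m.IsAdmissible 𝓕 μ N k p C θ)
    (hX : m.IsStateSolution 𝓕 μ N k p C θ K P) :
    ∀ᵐ ω ∂μ, ∀ᵐ t ∂lebNN, m.utility (C t ω) (P t ω) ≠ ⊥ := by
  have habs := EReal.measurable_abs
  have hm := hA.measurable_utilityProcess hX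
  have h := ae_lt_top (by fun_prop) (hA.lintegral_utility_lt_top hX).ne
  have h' := Measure.ae_ae_of_ae_prod h
  filter_upwards [h'] with ω hω
  filter_upwards [hω] with t ht h0
  simp only [h0, EReal.abs_bot] at ht
  rw [ENNReal.mul_top (by simpa using Real.exp_pos _)] at ht
  exact lt_irrefl _ ht

lemma integrable_utilityFlow [SFinite μ] (hA : m.IsAdmissible 𝓕 μ N k p C θ)
    (hX : m.IsStateSolution 𝓕 μ N k p C θ K P) :
    Integrable (m.utilityFlow C P) (μ.prod lebNN) := by
  have hm := hA.measurable_utilityProcess hX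
  have hmu : Measurable (m.utilityFlow C P) := by
    refine Measurable.mul ?_ (measurable_ereal_toReal.comp hm)
    fun_prop
  refine ⟨hmu.aestronglyMeasurable, ?_⟩
  refine lt_of_le_of_lt (lintegral_mono fun z => ?_) (hA.lintegral_utility_lt_top hX)
  rw [utilityFlow, enorm_mul, Real.enorm_of_nonneg (Real.exp_pos _).le]
  gcongr
  exact EReal.enorm_toReal_le_abs _

/-- Pathwise uniqueness makes the state chosen in the definition of the gain immaterial. -/
lemma gain_eq (hA : m.IsAdmissible 𝓕 μ N k p C θ)
    (hX : m.IsStateSolution 𝓕 μ N k p C θ K P) :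
    m.gain 𝓕 μ N k p C θ = ∫ ω, ∫ t, m.utilityFlow C P (ω, t) ∂lebNN ∂μ := by
  have h : ∃ X : (ℝ≥0 → Ω → ℝ) × (ℝ≥0 → Ω → ℝ), m.IsStateSolution 𝓕 μ N k p C θ X.1 X.2 :=
    ⟨(K, P), hX⟩
  rw [gain, dif_pos h]
  refine integral_congr_ae ?_
  filter_upwards [hA.unique_state _ _ _ _ h.choose_spec hX] with ω hω
  simp only [utilityFlow, fun t => (hω t).2]

lemma tendsto_integral_utilityFlow [SFinite μ] (hA : m.IsAdmissible 𝓕 μ N k p C θ)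
    (hX : m.IsStateSolution 𝓕 μ N k p C θ K P) :
    Tendsto (fun n : ℕ => ∫ ω, ∫ t in Set.Iic (n : ℝ≥0), m.utilityFlow C P (ω, t) ∂lebNN ∂μ) atTop
      (𝓝 (m.gain 𝓕 μ N k p C θ)) := by
  have hi := hA.integrable_utilityFlow hX
  have h1 := tendsto_setIntegral_of_monotone (μ := μ.prod lebNN) (f := m.utilityFlow C P)
    (s := fun n : ℕ => (Set.univ : Set Ω) ×ˢ Set.Iic (n : ℝ≥0))
    (fun n => MeasurableSet.univ.prod measurableSet_Iic)
    (fun i j hij => Set.prod_mono le_rfl (Set.Iic_subset_Iic.2 (by exact_mod_cast hij)))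
    hi.integrableOn
  have hU : ⋃ n : ℕ, (Set.univ : Set Ω) ×ˢ Set.Iic (n : ℝ≥0) = Set.univ := by
    refine Set.eq_univ_of_forall fun z => ?_
    obtain ⟨n, hn⟩ := exists_nat_ge z.2
    exact Set.mem_iUnion.2 ⟨n, trivial, hn⟩
  rw [hU, Measure.restrict_univ, integral_prod _ hi, ← hA.gain_eq hX] at h1
  refine h1.congr fun n => ?_
  rw [setIntegral_prod _ hi.integrableOn, Measure.restrict_univ]

lemma ae_nonneg_theta (hA : m.IsAdmissible 𝓕 μ N k p C θ) :
    ∀ᵐ ω ∂μ, ∀ᵐ t ∂lebNN, 0 ≤ θ t ω := by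
  filter_upwards [hA.mem_Icc] with ω h
  filter_upwards [h] with t ht using ht.1

/-- Dynkin's formula for the discounted value. -/
lemma dynkin [IsProbabilityMeasure μ] (hA : m.IsAdmissible 𝓕 μ N k p C θ)
    (hX : m.IsStateSolution 𝓕 μ N k p C θ K P) (hN : IsPoissonRandomMeasure 𝓕 μ N) (hk : 0 < k)
    (hv : ContDiffOn ℝ 2 v stateSpace) (hgrowth : PolynomialGrowth v) (T : ℝ≥0) :
    (∀ᵐ ω ∂μ, IntegrableOn (m.valueDrift v C θ K P ω) (Set.Iic T) lebNN) ∧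
    Integrable (fun ω => ∫ s in Set.Iic T, m.valueDrift v C θ K P ω s ∂lebNN) μ ∧
    ∫ ω, Real.exp (-m.ρ * T) * v (K T ω, P T ω) ∂μ
      = v (k, p) + ∫ ω, ∫ s in Set.Iic T, m.valueDrift v C θ K P ω s ∂lebNN ∂μ := by
  have hθ := hA.ae_nonneg_theta
  obtain ⟨M, hMi, hM0, hM⟩ :=
    hX.exists_martingale_part hN hA.nonneg hθ hk hv hgrowth T
  obtain ⟨B, hB0, hB⟩ := exists_value_bound hgrowth (k * Real.exp (m.A * T))
    (p + T * (m.φ * (m.A * (k * Real.exp (m.A * T)))))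
  have hvm : Measurable fun ω => v (K T ω, P T ω) := by
    have h1 := (measurable_indicator_stateSpace hv.continuousOn).comp
      (((hX.adaptedK T).mono (𝓕.le T) le_rfl).prodMk ((hX.adaptedP T).mono (𝓕.le T) le_rfl))
    convert h1 using 1
    ext ω
    exact (Set.indicator_of_mem (hX.mem T ω) v).symm
  have hvi : Integrable (fun ω => Real.exp (-m.ρ * T) * v (K T ω, P T ω)) μ := by
    refine Integrable.const_mul (Integrable.of_bound hvm.aestronglyMeasurable B ?_) _
    filter_upwards [hX.ae_capital_le hN hA.nonneg hθ, hX.ae_pollution_le hN hA.nonneg hθ hk]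
      with ω h1 h2
    exact hB _ _ ⟨(hX.mem T ω).1, h1 T⟩ ⟨(hX.mem T ω).2, h2 T⟩
  -- The drift involves an unbounded control, so its time integral is not estimated directly: it is
  -- integrable as a bounded value minus a constant minus `M`.
  have hR : (fun ω => Real.exp (-m.ρ * T) * v (K T ω, P T ω) - v (k, p) - M ω)
      =ᵐ[μ] fun ω => ∫ s in Set.Iic T, m.valueDrift v C θ K P ω s ∂lebNN := by
    filter_upwards [hM] with ω hω
    rw [hω.2]
    ring
  refine ⟨hM.mono fun ω h => h.1, ((hvi.sub (integrable_const _)).sub hMi).congr hR, ?_⟩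
  have hvi' : Integrable (fun ω => Real.exp (-m.ρ * T) * v (K T ω, P T ω) - v (k, p)) μ :=
    hvi.sub (integrable_const _)
  rw [← integral_congr_ae hR, integral_sub hvi' hMi, integral_sub hvi (integrable_const _), hM0]
  simp

lemma tendsto_integral_valueDrift [IsProbabilityMeasure μ] (hA : m.IsAdmissible 𝓕 μ N k p C θ)
    (hX : m.IsStateSolution 𝓕 μ N k p C θ K P) (hN : IsPoissonRandomMeasure 𝓕 μ N) (hk : 0 < k)
    (hv : ContDiffOn ℝ 2 v stateSpace) (hgrowth : PolynomialGrowth v)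
    (hTV : m.Transversality 𝓕 μ N v k p) :
    Tendsto (fun n : ℕ =>
        ∫ ω, ∫ s in Set.Iic (n : ℝ≥0), m.valueDrift v C θ K P ω s ∂lebNN ∂μ) atTop
      (𝓝 (-v (k, p))) := by
  have h1 := ((hTV C θ hA K P hX).comp (tendsto_natCast_atTop_atTop (R := ℝ≥0))).sub_const (v (k, p))
  rw [zero_sub] at h1
  refine h1.congr fun n => ?_
  simp only [Function.comp_apply]
  rw [(hA.dynkin hX hN hk hv hgrowth n).2.2]
  ring

/-- The HJB inequality bounds the drift by minus the utility flow; the truncated expectations tend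
to `-v(k, p)` and to minus the gain. -/
lemma gain_le [IsProbabilityMeasure μ] (hA : m.IsAdmissible 𝓕 μ N k p C θ)
    (hN : IsPoissonRandomMeasure 𝓕 μ N) (hk : 0 < k)
    (hv : ContDiffOn ℝ 2 v stateSpace) (hgrowth : PolynomialGrowth v)
    (hHJB : m.SolvesHJB v) (hTV : m.Transversality 𝓕 μ N v k p) :
    m.gain 𝓕 μ N k p C θ ≤ v (k, p) := by
  obtain ⟨K, P, hX⟩ := hA.exists_state
  have hlim1 := hA.tendsto_integral_valueDrift hX hN hk hv hgrowth hTV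
  have hlim2 := (hA.tendsto_integral_utilityFlow hX).neg
  refine neg_le_neg_iff.1 (le_of_tendsto_of_tendsto' hlim1 hlim2 fun n => ?_)
  have hi := hA.integrable_utilityFlow hX
  have hi' : IntegrableOn (m.utilityFlow C P) (Set.univ ×ˢ Set.Iic (n : ℝ≥0)) (μ.prod lebNN) :=
    hi.integrableOn
  rw [IntegrableOn, ← Measure.prod_restrict, Measure.restrict_univ] at hi'
  obtain ⟨hd1, hd2, -⟩ := hA.dynkin hX hN hk hv hgrowth (n : ℝ≥0)
  rw [← integral_neg]
  refine integral_mono_ae hd2 hi'.integral_prod_left.neg ?_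
  filter_upwards [hd1, hi'.prod_right_ae, hA.ae_utility_ne_bot hX, hA.nonneg, hA.mem_Icc]
    with ω h1 h2 hne hC hθ
  rw [← integral_neg]
  refine integral_mono_ae h1 h2.neg (ae_restrict_of_ae ?_)
  filter_upwards [hne, hC, hθ] with s h3 h4 h5
  have := hHJB.utility_add_generator_le (hX.mem s ω).1 (hX.mem s ω).2 h4 h5 h3
  simp only [valueDrift, utilityFlow]
  rw [← mul_neg]
  exact mul_le_mul_of_nonneg_left (by linarith) (Real.exp_pos _).le

/-- For a maximiser the drift equals minus the utility flow, so both limits belong to one sequence.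
-/
lemma gain_eq_value [IsProbabilityMeasure μ] (hA : m.IsAdmissible 𝓕 μ N k p C θ)
    (hX : m.IsStateSolution 𝓕 μ N k p C θ K P)
    (hN : IsPoissonRandomMeasure 𝓕 μ N) (hk : 0 < k)
    (hv : ContDiffOn ℝ 2 v stateSpace) (hgrowth : PolynomialGrowth v)
    (hHJB : m.SolvesHJB v) (hTV : m.Transversality 𝓕 μ N v k p)
    (hopt : ∀ t ω, m.utility (C t ω) (P t ω)
      + (m.generator v (C t ω) (θ t ω) (K t ω) (P t ω) : EReal) = m.hjbSup v (K t ω) (P t ω)) :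
    v (k, p) = m.gain 𝓕 μ N k p C θ := by
  have hlim1 := hA.tendsto_integral_valueDrift hX hN hk hv hgrowth hTV
  have hlim2 := (hA.tendsto_integral_utilityFlow hX).neg
  have heq : ∀ ω s, m.valueDrift v C θ K P ω s = -m.utilityFlow C P (ω, s) := by
    intro ω s
    have := hHJB.utility_add_generator_eq (hX.mem s ω).1 (hX.mem s ω).2 (hopt s ω)
    simp only [valueDrift, utilityFlow]
    rw [← mul_neg, ← this]
    ring
  simp_rw [heq, integral_neg] at hlim1
  exact neg_injective (tendsto_nhds_unique hlim1 hlim2)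

end IsAdmissible
end GrowthModel

end

theorem mainTheorem5 {Ω : Type*} {mΩ : MeasurableSpace Ω} (μ : Measure Ω) [IsProbabilityMeasure μ]
    (𝓕 : Filtration ℝ≥0 mΩ) (h𝓕 : UsualConditions 𝓕 μ)
    (N : Ω → Measure (ℝ≥0 × ℝ≥0)) (hN : IsPoissonRandomMeasure 𝓕 μ N)
    (m : GrowthModel) (v : ℝ × ℝ → ℝ)
    (hv : ContDiffOn ℝ 2 v stateSpace) (hgrowth : PolynomialGrowth v) (hHJB : m.SolvesHJB v)
    (k p : ℝ) (hk : 0 < k) (hp : 0 < p) (hTV : m.Transversality 𝓕 μ N v k p) :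
    (∀ C θ : ℝ≥0 → Ω → ℝ, m.IsAdmissible 𝓕 μ N k p C θ →
      m.gain 𝓕 μ N k p C θ ≤ v (k, p)) ∧
    (∀ Chat θhat : ℝ × ℝ → ℝ,
      Measurable (stateSpace.domRestrict Chat) → Measurable (stateSpace.domRestrict θhat) →
      (∀ x ∈ stateSpace, 0 ≤ Chat x ∧ θhat x ∈ Set.Icc (0 : ℝ) 1) →
      (∀ K P : ℝ, 0 < K → 0 < P →
        m.utility (Chat (K, P)) P + (m.generator v (Chat (K, P)) (θhat (K, P)) K P : EReal)
          = m.hjbSup v K P) →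
      ∀ K P : ℝ≥0 → Ω → ℝ,
        m.IsStateSolution 𝓕 μ N k p (fun t ω => Chat (K t ω, P t ω))
          (fun t ω => θhat (K t ω, P t ω)) K P →
        m.IsAdmissible 𝓕 μ N k p (fun t ω => Chat (K t ω, P t ω))
          (fun t ω => θhat (K t ω, P t ω)) →
        v (k, p) = m.gain 𝓕 μ N k p (fun t ω => Chat (K t ω, P t ω))
          (fun t ω => θhat (K t ω, P t ω)) ∧
        IsLUB {J : ℝ | ∃ C θ : ℝ≥0 → Ω → ℝ, m.IsAdmissible 𝓕 μ N k p C θ ∧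
          J = m.gain 𝓕 μ N k p C θ} (v (k, p))) := by
  have hgain : ∀ C θ : ℝ≥0 → Ω → ℝ, m.IsAdmissible 𝓕 μ N k p C θ →
      m.gain 𝓕 μ N k p C θ ≤ v (k, p) := fun C θ hA =>
    hA.gain_le hN hk hv hgrowth hHJB hTV
  refine ⟨hgain, fun Chat θhat _ _ _ hmax K P hX hA => ?_⟩
  have heq := hA.gain_eq_value hX hN hk hv hgrowth hHJB hTV fun t ω =>
    hmax (K t ω) (P t ω) (hX.mem t ω).1 (hX.mem t ω).2
  refine ⟨heq, ?_, fun b hb => hb ⟨_, _, hA, heq⟩⟩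
  rintro _ ⟨C, θ, hA', rfl⟩
  exact hgain C θ hA'
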